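/- **Theorem.** Let $c_0,c_1>0$. For every $\Delta>0$ with $c_0\Delta\le 1$ and $c_1\Delta\le 1$, let $(Y_t)_{t\in\mathbb N}$ (depending on $\Delta$) be a Markov chain with values in $\{-1,1\}$ and transition probabilities $$\pi^\Delta(-1,1)=c_0\Delta,\quad \pi^\Delta(-1,-1)=1-c_0\Delta,\quad \pi^\Delta(1,-1)=c_1\Delta,\quad \pi^\Delta(1,1)=1-c_1\Delta .$$ Put $X_t=\sum_{i=0}^t Y_i$, and let $(\tilde Z^\Delta_s)_{s\ge 0}$ be the continuous process obtained by linear interpolation from the values $\tilde Z^\Delta_{n\Delta}=\Delta X_n$, $n\in\mathbb N$ (that is, time and space are rescaled with $\Delta_t=\Delta_x=\Delta$). Let $(e_n)_{n\ge1}$ be independent exponential random variables with $\mathbb E[e_n]=1$. For $a,b>0$ put $\lambda_k=1/a$ for odd $k$ and $\lambda_k=1/b$ for even $k$, and define, for $t\ge 0$, $$N^{a,b}_t=\sum_{k\ge1}\mathbf 1_{\{\lambda_1e_1+\dots+\lambda_ke_k\le t\}},\qquad Z^{a,b}_t=\int_0^t(-1)^{N^{a,b}_u}\,du .$$ Almost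 surely $N^{a,b}_t<\infty$ for all $t$. Convergence in distribution of processes means weak convergence of their laws on $C([0,\infty),\mathbb R)$ with the topology of uniform convergence on compact sets. 1. If $Y_0=X_0=-1$ almost surely for every $\Delta$, then $(\tilde Z^\Delta_s)_{s\ge0}$ converges in distribution, as $\Delta\to0$, to $(-Z^{c_0,c_1}_s)_{s\ge0}$. 2. If $c_0=c_1$, then $(N^{c_0,c_0}_t)_{t\ge0}$ is a Poisson process of rate $c_0$. 3. If $Y_0=X_0=1$ almost surely for every $\Delta$, then $(\tilde Z^\Delta_s)_{s\ge0}$ converges in distribution, as $\Delta\to0$, to $(Z^{c_1,c_0}_s)_{s\ge0}$. -/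

import Mathlib

open MeasureTheory ProbabilityTheory Filter Topology
open scoped NNReal

noncomputable section

/-! ### Path space

`C(ℝ≥0, ℝ)` carries Mathlib's compact-open topology (uniform convergence on compact time
intervals); we equip it with its Borel σ-algebra. -/

instance pathMeasurableSpace : MeasurableSpace C(ℝ≥0, ℝ) := borel _

instance pathBorelSpace : BorelSpace C(ℝ≥0, ℝ) := ⟨rfl⟩

/-! ### The persistent random walk -/

/-- The transition matrix on `{-1, 1} = ℤˣ`: probability `α` of leaving `-1` and probability
`β` of leaving `1`. -/
def transitionMatrix (α β : ℝ) : Matrix ℤˣ ℤˣ ℝ := fun x y =>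
  if x = -1 then (if y = 1 then α else 1 - α) else (if y = -1 then β else 1 - β)

/-- `Y` is a Markov chain with state space `{-1, 1}` and transition matrix `p`: each `Y n` is a
random variable, and given any history `Y 0 = y 0, …, Y n = y n` of positive probability, the
conditional probability of `Y (n + 1) = b` is `p (y n) b`. -/
structure IsMarkovChain {Ω : Type*} [MeasurableSpace Ω] (Y : ℕ → Ω → ℤˣ)
    (p : Matrix ℤˣ ℤˣ ℝ) (μ : Measure Ω) : Prop where
  measurable : ∀ n, Measurable (Y n)
  markov : ∀ (n : ℕ) (y : ℕ → ℤˣ) (b : ℤˣ), μ {ω | ∀ i ≤ n, Y i ω = y i} ≠ 0 →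
    μ[|{ω | ∀ i ≤ n, Y i ω = y i}] {ω | Y (n + 1) ω = b} = ENNReal.ofReal (p (y n) b)

/-- The persistent random walk `X_t = Y_0 + ⋯ + Y_t` (so `X_0 = Y_0`). -/
def persistentWalk {Ω : Type*} (Y : ℕ → Ω → ℤˣ) (t : ℕ) (ω : Ω) : ℤ :=
  ∑ i ∈ Finset.range (t + 1), (Y i ω : ℤ)

/-- Linear interpolation of the sequence `x 0, x 1, x 2, …` at real times `u ≥ 0`. -/
def linInterp (x : ℕ → ℝ) (u : ℝ≥0) : ℝ :=
  x ⌊u⌋₊ + ((u : ℝ) - ⌊u⌋₊) * (x (⌊u⌋₊ + 1) - x ⌊u⌋₊)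

theorem linInterp_aux (x : ℕ → ℝ) (N : ℕ) (u : ℝ≥0) :
    x 0 + ∑ i ∈ Finset.range N, (x (i + 1) - x i) * max 0 (min 1 ((u : ℝ) - i)) =
      if u < N then linInterp x u else x N := by
  induction N with
  | zero => simp
  | succ N ih =>
    rw [Finset.sum_range_succ, ← add_assoc, ih]
    by_cases h1 : u < N
    · have h1' : (u : ℝ) < N := by exact_mod_cast h1
      have h2 : u < ((N + 1 : ℕ) : ℝ≥0) := h1.trans (by push_cast; simp)
      rw [if_pos h1, if_pos h2, max_eq_left ((min_le_right _ _).trans (by linarith))]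
      ring
    · rw [if_neg h1]
      have h1' : (N : ℝ) ≤ u := by exact_mod_cast not_lt.1 h1
      by_cases h2 : u < ((N + 1 : ℕ) : ℝ≥0)
      · have h2' : (u : ℝ) < N + 1 := by exact_mod_cast h2
        have hf : ⌊u⌋₊ = N := by
          rw [Nat.floor_eq_iff (zero_le)]
          exact ⟨not_lt.1 h1, by exact_mod_cast h2⟩
        rw [if_pos h2, linInterp, hf, min_eq_right (by linarith), max_eq_right (by linarith)]
        ring
      · have h2' : (N : ℝ) + 1 ≤ u := by exact_mod_cast not_lt.1 h2
        rw [if_neg h2, min_eq_left (by linarith), max_eq_right zero_le_one]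
        ring

theorem continuous_linInterp (x : ℕ → ℝ) : Continuous (linInterp x) := by
  rw [continuous_iff_continuousAt]
  intro u
  obtain ⟨N, hN⟩ := exists_nat_gt u
  have hc : Continuous fun v : ℝ≥0 =>
      x 0 + ∑ i ∈ Finset.range N, (x (i + 1) - x i) * max 0 (min 1 ((v : ℝ) - i)) := by
    fun_prop
  refine hc.continuousAt.congr ?_
  filter_upwards [Iio_mem_nhds hN] with v hv
  rw [linInterp_aux, if_pos (Set.mem_Iio.1 hv)]

/-- The interpolated normalized walk `s ↦ Z̃^Δ_s` as a random element of path space: the linear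
interpolation of `Z^Δ_s = Δx * X_{s / Δt}`, `s ∈ Δt ℕ`. -/
def scaledWalk {Ω : Type*} (Δx Δt : ℝ≥0) (Y : ℕ → Ω → ℤˣ) (ω : Ω) : C(ℝ≥0, ℝ) where
  toFun s := linInterp (fun n => Δx * (persistentWalk Y n ω : ℝ)) (s / Δt)
  continuous_toFun := (continuous_linInterp _).comp (by fun_prop)

/-- The admissible step sizes: `Δ > 0` for which `c₀ Δ` and `c₁ Δ` are probabilities. -/
abbrev StepSize (c₀ c₁ : ℝ≥0) : Type :=
  {Δ : ℝ≥0 // 0 < Δ ∧ c₀ * Δ ≤ 1 ∧ c₁ * Δ ≤ 1}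

/-- The limit `Δ → 0` along admissible step sizes. -/
def stepToZero (c₀ c₁ : ℝ≥0) : Filter (StepSize c₀ c₁) := comap Subtype.val (𝓝 0)

/-! ### The integrated telegraph noise

The i.i.d. sequence `e_1, e_2, …` is indexed from `0` here: `e k` stands for `e_{k+1}`. -/

/-- `e` is a sequence of independent exponential random variables of mean `1`. -/
structure IsStdExpSequence {Ω : Type*} [MeasurableSpace Ω] (e : ℕ → Ω → ℝ)
    (P : Measure Ω) : Prop where
  measurable : ∀ k, Measurable (e k)
  indep : iIndepFun e P
  law : ∀ k, HasLaw (e k) (expMeasure 1) P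

/-- The mean `λ_{k+1}` of the `(k+1)`-st holding time: `1 / c₀` if `k + 1` is odd, `1 / c₁`
if `k + 1` is even. -/
def holdingMean (c₀ c₁ : ℝ≥0) (k : ℕ) : ℝ := if Odd (k + 1) then 1 / c₀ else 1 / c₁

/-- The `(k+1)`-st jump time `λ_1 e_1 + ⋯ + λ_{k+1} e_{k+1}`. -/
def jumpTime {Ω : Type*} (c₀ c₁ : ℝ≥0) (e : ℕ → Ω → ℝ) (k : ℕ) (ω : Ω) : ℝ :=
  ∑ i ∈ Finset.range (k + 1), holdingMean c₀ c₁ i * e i ω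

/-- The counting process `N^{c₀,c₁}_t`, the number of jump times that are `≤ t`. It takes values
in `ℕ∞`; the value `⊤` would mean infinitely many jump times in `[0, t]`. -/
def countingProcess {Ω : Type*} (c₀ c₁ : ℝ≥0) (e : ℕ → Ω → ℝ) (t : ℝ) (ω : Ω) : ℕ∞ :=
  {k : ℕ | jumpTime c₀ c₁ e k ω ≤ t}.encard

theorem countingProcess_mono {Ω : Type*} (c₀ c₁ : ℝ≥0) (e : ℕ → Ω → ℝ) (ω : Ω) :
    Monotone fun t => countingProcess c₀ c₁ e t ω :=
  fun _ _ h => Set.encard_le_encard fun _ hk => le_trans hk h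

/-- The telegraph noise `(-1)^{N_t}` (its value where `N_t = ⊤`, a null event, is irrelevant). -/
def telegraphNoise {Ω : Type*} (c₀ c₁ : ℝ≥0) (e : ℕ → Ω → ℝ) (t : ℝ) (ω : Ω) : ℝ :=
  (-1) ^ (countingProcess c₀ c₁ e t ω).toNat

theorem measurable_telegraphNoise {Ω : Type*} (c₀ c₁ : ℝ≥0) (e : ℕ → Ω → ℝ) (ω : Ω) :
    Measurable fun t => telegraphNoise c₀ c₁ e t ω := by
  have h : Measurable fun t => countingProcess c₀ c₁ e t ω :=
    measurable_to_countable' fun n =>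
      (Set.ordConnected_singleton.preimage_mono (countingProcess_mono c₀ c₁ e ω)).measurableSet
  exact (measurable_of_countable fun n : ℕ∞ => (-1 : ℝ) ^ n.toNat).comp h

/-- The integrated telegraph noise `Z^{c₀,c₁}_t = ∫_0^t (-1)^{N_u} du` as a random element of
path space. -/
def itn {Ω : Type*} (c₀ c₁ : ℝ≥0) (e : ℕ → Ω → ℝ) (ω : Ω) : C(ℝ≥0, ℝ) where
  toFun t := ∫ u in (0 : ℝ)..t, telegraphNoise c₀ c₁ e u ω
  continuous_toFun := by
    have h : ∀ a b : ℝ,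
        IntervalIntegrable (fun u => telegraphNoise c₀ c₁ e u ω) volume a b := fun a b =>
      (intervalIntegrable_const (c := (1 : ℝ))).mono_fun
        (measurable_telegraphNoise c₀ c₁ e ω).aestronglyMeasurable
        (Eventually.of_forall fun u => by simp [telegraphNoise])
    exact (intervalIntegral.continuous_primitive h 0).comp NNReal.continuous_coe

/-- `N` is a Poisson process of rate `r`: it starts at `0`, its paths are nondecreasing and
right-continuous, and its increments are independent, with `N_t - N_s` Poisson of mean
`r (t - s)`. The truncated subtraction of `ℕ` is harmless since almost every path is
nondecreasing. -/
structure IsPoissonProcess {Ω : Type*} [MeasurableSpace Ω] (N : ℝ≥0 → Ω → ℕ) (r : ℝ≥0)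
    (P : Measure Ω) : Prop where
  zero : ∀ᵐ ω ∂P, N 0 ω = 0
  mono : ∀ᵐ ω ∂P, Monotone fun t => N t ω
  rightCont : ∀ᵐ ω ∂P, ∀ t, ContinuousWithinAt (fun s => N s ω) (Set.Ici t) t
  indep : HasIndepIncrements N P
  law : ∀ s t, s ≤ t → HasLaw (fun ω => N t ω - N s ω) (poissonMeasure (r * (t - s))) P

end

/-! The proof is a coupling. The chain stays in state `x` with probability `1 - ρ x * Δ` per step,
where `ρ x` is `c₀` or `c₁`, so its holding times are independent and geometric. If `e` is standard
exponential, then `⌊e / θ⌋₊` is geometric with failure probability `exp (-θ)`. Taking `θ = -log (1 -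
ρ x * Δ)` therefore builds the chains, for all small `Δ`, from the very sequence `e` that drives the
limit (`isGeometricSequence_floor`, `hasTransitions_renewalChain`). Each coupled chain has the law
of the given one, because transition probabilities and starting point determine the law
(`HasTransitions.map_eq`).

For the coupled chains convergence is almost sure. Since `Δ / θ → 1 / ρ x`, rescaled renewal times
converge to the jump times. The walk is the integral of a velocity `±1`, which converges at every
time that is not a jump time. Dominated convergence gives convergence of velocities in `L¹` on
bounded intervals, hence uniform convergence of paths (`tendsto_scaledWalk_renewalChain`). Almost
sure convergence together with equality of laws gives convergence in distribution.

For equal rates the same discretization has i.i.d. Bernoulli flips, so the joint generating function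
of its increments is a product. Its limit gives Poisson increments and their independence through
characteristic functions. Finiteness of the counting process follows from the second Borel–Cantelli
lemma. -/

/-! ### Discrete renewal processes -/

/-- The time of the `m`-th renewal when the `i`-th holding time is `F i + 1`. -/
def renewalTime (F : ℕ → ℕ) (m : ℕ) : ℕ := ∑ i ∈ Finset.range m, (F i + 1)

/-- The number of renewals up to time `n`. -/
def renewalCount (F : ℕ → ℕ) (n : ℕ) : ℕ := Nat.findGreatest (fun m => renewalTime F m ≤ n) n

theorem renewalTime_succ (F : ℕ → ℕ) (m : ℕ) :
    renewalTime F (m + 1) = renewalTime F m + (F m + 1) :=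
  Finset.sum_range_succ _ _

theorem renewalTime_strictMono (F : ℕ → ℕ) : StrictMono (renewalTime F) :=
  strictMono_nat_of_lt_succ fun m => by rw [renewalTime_succ]; omega

theorem renewalCount_eq_iff {F : ℕ → ℕ} {n m : ℕ} :
    renewalCount F n = m ↔ renewalTime F m ≤ n ∧ n < renewalTime F (m + 1) := by
  have hm := renewalTime_strictMono F
  rw [renewalCount, Nat.findGreatest_eq_iff]
  constructor
  · rintro ⟨h1, h2, h3⟩
    refine ⟨?_, ?_⟩
    · rcases eq_or_ne m 0 with rfl | h0
      · simp [renewalTime]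
      · exact h2 h0
    · by_contra! h
      exact h3 (Nat.lt_succ_self m) ((hm.le_apply).trans h) h
  · rintro ⟨h1, h2⟩
    -- The cap `n` in `Nat.findGreatest` is harmless: holding times are at least `1`, so `m ≤
    -- renewalTime F m`.
    refine ⟨hm.le_apply.trans h1, fun _ => h1, fun k hk _ h => ?_⟩
    have := hm.monotone (Nat.succ_le_of_lt hk)
    simp only [Nat.succ_eq_add_one] at this
    omega

theorem renewalCount_zero (F : ℕ → ℕ) : renewalCount F 0 = 0 := by
  rw [renewalCount_eq_iff]
  simp [renewalTime]

/-- Holding times are at least `1`, so a single step contains at most one renewal. -/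
theorem renewalCount_succ (F : ℕ → ℕ) (n : ℕ) :
    renewalCount F (n + 1) = if renewalTime F (renewalCount F n + 1) = n + 1
      then renewalCount F n + 1 else renewalCount F n := by
  obtain ⟨h1, h2⟩ := renewalCount_eq_iff.1 (rfl : renewalCount F n = _)
  split_ifs with h
  · rw [renewalCount_eq_iff]
    have := renewalTime_strictMono F (Nat.lt_succ_self (renewalCount F n + 1))
    simp only [Nat.succ_eq_add_one] at this
    omega
  · rw [renewalCount_eq_iff]
    omega

/-- The set of holding-time sequences whose first renewal counts are prescribed is either empty
or prescribes finitely many holding times and bounds the next one from below. -/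
theorem renewalCount_path (v : ℕ → ℕ) (n : ℕ) :
    (∀ F, ¬ ∀ i ≤ n, renewalCount F i = v i) ∨
      ∃ (g : ℕ → ℕ) (r : ℕ), renewalTime g (v n) + r = n ∧
        ∀ F, (∀ i ≤ n, renewalCount F i = v i) ↔ (∀ i < v n, F i = g i) ∧ r ≤ F (v n) := by
  have htime : ∀ {F g : ℕ → ℕ} {m : ℕ}, (∀ i < m, F i = g i) →
      renewalTime F m = renewalTime g m := fun h =>
    Finset.sum_congr rfl fun i hi => by rw [h i (Finset.mem_range.1 hi)]
  induction n with
  | zero =>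
    by_cases h0 : v 0 = 0
    · exact Or.inr ⟨0, 0, by simp [h0, renewalTime], fun F => by simp [h0, renewalCount_zero]⟩
    · refine Or.inl fun F hF => h0 ?_
      rw [← hF 0 le_rfl, renewalCount_zero]
  | succ n ih =>
    have hsplit : ∀ F, (∀ i ≤ n + 1, renewalCount F i = v i) ↔
        (∀ i ≤ n, renewalCount F i = v i) ∧ renewalCount F (n + 1) = v (n + 1) := fun F =>
      ⟨fun h => ⟨fun i hi => h i (by omega), h _ le_rfl⟩, fun h i hi => by
        rcases Nat.lt_or_ge n i with h' | h'
        · obtain rfl : i = n + 1 := by omega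
          exact h.2
        · exact h.1 i h'⟩
    rcases ih with ih | ⟨g, r, hr, ih⟩
    · exact Or.inl fun F hF => ih F ((hsplit F).1 hF).1
    -- The last renewal was `r` steps before `n`, so the next falls at `n + 1` exactly when the
    -- current holding variable equals `r`.
    have hstep : ∀ F, (∀ i ≤ n, renewalCount F i = v i) →
        renewalCount F (n + 1) = if F (v n) = r then v n + 1 else v n := by
      intro F hF
      have hg := ((ih F).1 hF).1
      rw [renewalCount_succ, hF n le_rfl, renewalTime_succ, htime hg]
      exact if_congr (by omega) rfl rfl
    -- Without a renewal the lower bound rises to `r + 1`; with one, the current variable is fixed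
    -- at `r` and the bound on the next one restarts at `0`; any other increment is impossible.
    by_cases hs : v (n + 1) = v n
    · refine Or.inr ⟨g, r + 1, by rw [hs]; omega, fun F => ?_⟩
      rw [hsplit, hs]
      constructor
      · rintro ⟨h1, h2⟩
        rw [hstep F h1] at h2
        obtain ⟨h3, h4⟩ := (ih F).1 h1
        refine ⟨h3, ?_⟩
        split_ifs at h2 with h
        · omega
        · omega
      · rintro ⟨h1, h2⟩
        have h3 := (ih F).2 ⟨h1, by omega⟩
        exact ⟨h3, by rw [hstep F h3, if_neg (by omega)]⟩
    by_cases hs' : v (n + 1) = v n + 1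
    · refine Or.inr ⟨Function.update g (v n) r, 0, ?_, fun F => ?_⟩
      · rw [hs', renewalTime_succ, htime (g := g) fun i hi => by
          rw [Function.update_of_ne (by omega)], Function.update_self]
        omega
      · rw [hsplit, hs']
        constructor
        · rintro ⟨h1, h2⟩
          rw [hstep F h1] at h2
          obtain ⟨h3, h4⟩ := (ih F).1 h1
          have h5 : F (v n) = r := by
            by_contra h
            simp [h] at h2
          refine ⟨fun i hi => ?_, Nat.zero_le _⟩
          rcases eq_or_ne i (v n) with rfl | hi'
          · rw [h5, Function.update_self]
          · rw [Function.update_of_ne hi', h3 i (by omega)]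
        · rintro ⟨h1, -⟩
          have h5 : F (v n) = r := by rw [h1 _ (by omega), Function.update_self]
          have h3 := (ih F).2 ⟨fun i hi => by
            rw [h1 i (by omega), Function.update_of_ne (by omega)], h5.ge⟩
          exact ⟨h3, by rw [hstep F h3, if_pos h5]⟩
    · refine Or.inl fun F hF => ?_
      obtain ⟨h1, h2⟩ := (hsplit F).1 hF
      rw [hstep F h1] at h2
      split_ifs at h2 <;> omega

/-- `F` is a sequence of independent geometric random variables, `F k` having failure
probability `a k`. -/
structure IsGeometricSequence {Ω : Type*} [MeasurableSpace Ω] (F : ℕ → Ω → ℕ) (a : ℕ → ℝ)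
    (P : Measure Ω) : Prop where
  measurable : ∀ k, Measurable (F k)
  indep : iIndepFun F P
  tail : ∀ k r, P {ω | r ≤ F k ω} = ENNReal.ofReal (a k ^ r)
  nonneg : ∀ k, 0 ≤ a k
  le_one : ∀ k, a k ≤ 1

/-- The conditional probability of seeing `j` renewals in one step. -/
def flipProb (a : ℝ) (j : ℕ) : ℝ := if j = 0 then a else if j = 1 then 1 - a else 0

theorem measurable_renewalCount {Ω : Type*} [MeasurableSpace Ω] {F : ℕ → Ω → ℕ}
    (hF : ∀ k, Measurable (F k)) (n : ℕ) :
    Measurable fun ω => renewalCount (fun k => F k ω) n := by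
  have hS : ∀ m, Measurable fun ω => renewalTime (fun k => F k ω) m := fun m =>
    Finset.measurable_fun_sum _ fun i _ => (hF i).add_const 1
  refine measurable_to_countable' fun m => ?_
  have : (fun ω => renewalCount (fun k => F k ω) n) ⁻¹' {m} =
      {ω | renewalTime (fun k => F k ω) m ≤ n} ∩
        {ω | n < renewalTime (fun k => F k ω) (m + 1)} := by
    ext ω
    exact renewalCount_eq_iff
  rw [this]
  exact (measurableSet_le (hS m) measurable_const).inter
    (measurableSet_lt measurable_const (hS (m + 1)))

/-- This is the lack of memory of the geometric law. By `renewalCount_path` the past only fixes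
earlier holding variables and requires `F m ≥ r`; one more step refines this to `F m ≥ r + 1` or `F
m = r`, which multiplies the probability by `a m` or `1 - a m`. -/
theorem IsGeometricSequence.measure_path_succ {Ω : Type*} [MeasurableSpace Ω] {F : ℕ → Ω → ℕ}
    {a : ℕ → ℝ} {P : Measure Ω} (hF : IsGeometricSequence F a P)
    {v : ℕ → ℕ} {n j : ℕ} (hv : v (n + 1) = v n + j) :
    P {ω | ∀ i ≤ n + 1, renewalCount (fun k => F k ω) i = v i} =
      P {ω | ∀ i ≤ n, renewalCount (fun k => F k ω) i = v i} *
        ENNReal.ofReal (flipProb (a (v n)) j) := by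
  have := hF.indep.isProbabilityMeasure
  rcases renewalCount_path v n with h | ⟨g, r, hr, h⟩
  · have h1 : {ω | ∀ i ≤ n, renewalCount (fun k => F k ω) i = v i} = ∅ :=
      Set.eq_empty_of_forall_notMem fun ω hω => h _ hω
    have h2 : {ω | ∀ i ≤ n + 1, renewalCount (fun k => F k ω) i = v i} = ∅ :=
      Set.eq_empty_of_forall_notMem fun ω hω => h _ fun i hi => hω i (by omega)
    simp only [h1, h2, measure_empty, zero_mul]
  · set m := v n with hm
    have hprod : ∀ T : Set ℕ, P {ω | (∀ i < m, F i ω = g i) ∧ F m ω ∈ T} =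
        (∏ i ∈ Finset.range m, P (F i ⁻¹' {g i})) * P (F m ⁻¹' T) := by
      intro T
      have := hF.indep.measure_inter_preimage_eq_mul (Finset.range (m + 1))
        (sets := fun i => if i = m then T else {g i}) (fun _ _ => MeasurableSet.of_discrete)
      rw [Finset.prod_range_succ, if_pos rfl] at this
      rw [Finset.prod_congr rfl (g := fun i => P (F i ⁻¹' {g i}))
        (fun i hi => by rw [if_neg (Finset.mem_range.1 hi).ne])] at this
      rw [← this]
      congr 1
      ext ω
      simp only [Set.mem_ofPred_eq, Set.mem_iInter, Finset.mem_range, Set.mem_preimage]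
      constructor
      · rintro ⟨h1, h2⟩ i hi
        split_ifs with h3
        · rwa [h3]
        · exact h1 i (by omega)
      · intro h1
        exact ⟨fun i hi => by simpa [hi.ne] using h1 i (by omega), by simpa using h1 m (by omega)⟩
    have hA : {ω | ∀ i ≤ n, renewalCount (fun k => F k ω) i = v i} =
        {ω | (∀ i < m, F i ω = g i) ∧ F m ω ∈ Set.Ici r} := by
      ext ω; exact h _
    have hB : {ω | ∀ i ≤ n + 1, renewalCount (fun k => F k ω) i = v i} =
        {ω | (∀ i < m, F i ω = g i) ∧
          F m ω ∈ {l | r ≤ l ∧ (if l = r then 1 else 0) = j}} := by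
      ext ω
      have hsplit : (∀ i ≤ n + 1, renewalCount (fun k => F k ω) i = v i) ↔
          (∀ i ≤ n, renewalCount (fun k => F k ω) i = v i) ∧
            renewalCount (fun k => F k ω) (n + 1) = v (n + 1) :=
        ⟨fun h => ⟨fun i hi => h i (by omega), h _ le_rfl⟩, fun h i hi => by
          rcases Nat.lt_or_ge n i with h' | h'
          · obtain rfl : i = n + 1 := by omega
            exact h.2
          · exact h.1 i h'⟩
      have hstep : (∀ i ≤ n, renewalCount (fun k => F k ω) i = v i) →
          renewalCount (fun k => F k ω) (n + 1) = m + if F m ω = r then 1 else 0 := by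
        intro hω
        have hg := ((h _).1 hω).1
        have ht : renewalTime (fun k => F k ω) m = renewalTime g m :=
          Finset.sum_congr rfl fun i hi => by simp only [hg i (Finset.mem_range.1 hi)]
        rw [renewalCount_succ, hω n le_rfl, ← hm, renewalTime_succ, ht]
        split_ifs <;> omega
      simp only [Set.mem_ofPred_eq]
      rw [hsplit, hv, ← and_assoc, ← h fun k => F k ω]
      refine and_congr_right fun hω => ?_
      rw [hstep hω]
      omega
    have htail : ∀ r, P (F m ⁻¹' Set.Ici r) = ENNReal.ofReal (a m ^ r) := hF.tail m
    rw [hA, hB, hprod, hprod, mul_assoc, htail]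
    congr 1
    have hle := hF.le_one m
    have h0 := hF.nonneg m
    rw [← ENNReal.ofReal_mul (by positivity)]
    by_cases j0 : j = 0
    · have : {l | r ≤ l ∧ (if l = r then 1 else 0) = j} = Set.Ici (r + 1) := by
        ext l; simp only [Set.mem_ofPred_eq, Set.mem_Ici]; split_ifs <;> omega
      rw [this, htail, flipProb, if_pos j0, pow_succ]
    by_cases j1 : j = 1
    · have : {l | r ≤ l ∧ (if l = r then 1 else 0) = j} = Set.Ici r \ Set.Ici (r + 1) := by
        ext l; simp only [Set.mem_ofPred_eq, Set.mem_Ici, Set.mem_sdiff]; split_ifs <;> omega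
      rw [this, Set.preimage_sdiff, measure_sdiff (Set.preimage_mono (Set.Ici_subset_Ici.2 (by omega)))
        ((hF.measurable m) MeasurableSet.of_discrete).nullMeasurableSet (measure_ne_top _ _),
        htail, htail, ← ENNReal.ofReal_sub _ (by positivity), flipProb, if_neg j0, if_pos j1]
      congr 1
      ring
    · have : {l | r ≤ l ∧ (if l = r then 1 else 0) = j} = ∅ := by
        refine Set.eq_empty_of_forall_notMem fun l hl => ?_
        have h2 := hl.2
        split_ifs at h2 <;> omega
      simp [this, flipProb, j0, j1]

/-! ### Two-state Markov chains -/

theorem units_eq_or_neg (x y : ℤˣ) : x = y ∨ x = -y := by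
  rcases Int.units_eq_one_or x with rfl | rfl <;> rcases Int.units_eq_one_or y with rfl | rfl <;>
    simp

/-- The function `ρ` collects the two leaving probabilities, so that both states can be treated at
once. -/
theorem transitionMatrix_self {α β : ℝ} {ρ : ℤˣ → ℝ} (h0 : ρ (-1) = α) (h1 : ρ 1 = β) (x : ℤˣ) :
    transitionMatrix α β x x = 1 - ρ x := by
  rcases Int.units_eq_one_or x with rfl | rfl <;> simp [transitionMatrix, h0, h1]

theorem transitionMatrix_neg {α β : ℝ} {ρ : ℤˣ → ℝ} (h0 : ρ (-1) = α) (h1 : ρ 1 = β) (x : ℤˣ) :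
    transitionMatrix α β x (-x) = ρ x := by
  rcases Int.units_eq_one_or x with rfl | rfl <;> simp [transitionMatrix, h0, h1]

/-- The state space `{-1, 1}` has the discrete σ-algebra. -/
instance : DiscreteMeasurableSpace ℤˣ :=
  have : MeasurableSingletonClass ℤˣ := ⟨fun x => ⟨{(x : ℤ)}, MeasurableSet.of_discrete, by
    ext y; simp [Units.ext_iff]⟩⟩
  MeasurableSingletonClass.toDiscreteMeasurableSpace

/-- The transition probabilities determine the probability of every finite path from that of the
path without its last step. -/
def HasTransitions {Ω : Type*} [MeasurableSpace Ω] (Y : ℕ → Ω → ℤˣ) (p : Matrix ℤˣ ℤˣ ℝ)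
    (μ : Measure Ω) : Prop :=
  ∀ (n : ℕ) (y : ℕ → ℤˣ), μ {ω | ∀ i ≤ n + 1, Y i ω = y i} =
    μ {ω | ∀ i ≤ n, Y i ω = y i} * ENNReal.ofReal (p (y n) (y (n + 1)))

/-- Multiplying out the conditioning also covers histories of probability zero, where both sides
vanish. -/
theorem IsMarkovChain.hasTransitions {Ω : Type*} [MeasurableSpace Ω] {Y : ℕ → Ω → ℤˣ}
    {p : Matrix ℤˣ ℤˣ ℝ} {μ : Measure Ω} [IsFiniteMeasure μ] (h : IsMarkovChain Y p μ) :
    HasTransitions Y p μ := by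
  intro n y
  have hsplit : {ω | ∀ i ≤ n + 1, Y i ω = y i} =
      {ω | ∀ i ≤ n, Y i ω = y i} ∩ {ω | Y (n + 1) ω = y (n + 1)} := by
    ext ω
    refine ⟨fun h => ⟨fun i hi => h i (by omega), h _ le_rfl⟩, fun h i hi => ?_⟩
    rcases Nat.lt_or_ge n i with h' | h'
    · obtain rfl : i = n + 1 := by omega
      exact h.2
    · exact h.1 i h'
  have hm : MeasurableSet {ω | ∀ i ≤ n, Y i ω = y i} := by
    have : {ω | ∀ i ≤ n, Y i ω = y i} = ⋂ i ∈ Set.Iic n, Y i ⁻¹' {y i} := by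
      ext ω; simp
    rw [this]
    exact MeasurableSet.biInter (Set.to_countable _) fun i _ =>
      h.measurable i MeasurableSet.of_discrete
  by_cases h0 : μ {ω | ∀ i ≤ n, Y i ω = y i} = 0
  · rw [h0, zero_mul, hsplit]
    exact measure_mono_null Set.inter_subset_left h0
  · rw [← h.markov n y _ h0, hsplit, mul_comm, cond_mul_eq_inter hm]

/-- Induction on length equates the probabilities of finite paths, hence the marginals on initial
segments; these determine a finite measure on sequence space as a projective limit. -/
theorem HasTransitions.map_eq {Ω Ω' : Type*} [MeasurableSpace Ω] [MeasurableSpace Ω']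
    {μ : Measure Ω} {μ' : Measure Ω'} [IsFiniteMeasure μ] [IsFiniteMeasure μ']
    {Y : ℕ → Ω → ℤˣ} {Y' : ℕ → Ω' → ℤˣ}
    {p : Matrix ℤˣ ℤˣ ℝ} (h : HasTransitions Y p μ) (h' : HasTransitions Y' p μ')
    (hY : ∀ n, Measurable (Y n)) (hY' : ∀ n, Measurable (Y' n))
    (h0 : ∀ x, μ {ω | Y 0 ω = x} = μ' {ω | Y' 0 ω = x}) :
    μ.map (fun ω n => Y n ω) = μ'.map (fun ω n => Y' n ω) := by
  have hYm := measurable_pi_iff.2 hY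
  have hYm' := measurable_pi_iff.2 hY'
  have hpath : ∀ n (y : ℕ → ℤˣ), μ {ω | ∀ i ≤ n, Y i ω = y i} =
      μ' {ω | ∀ i ≤ n, Y' i ω = y i} := by
    intro n y
    induction n with
    | zero => simpa using h0 (y 0)
    | succ n ih => rw [h, h', ih]
  have hfin : ∀ n, (μ.map (fun ω n => Y n ω)).map (Preorder.frestrictLe n) =
      (μ'.map (fun ω n => Y' n ω)).map (Preorder.frestrictLe n) := by
    intro n
    refine Measure.ext_of_singleton fun z => ?_
    let y : ℕ → ℤˣ := fun i => if hi : i ≤ n then z ⟨i, Finset.mem_Iic.2 hi⟩ else 1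
    have hz : Preorder.frestrictLe (π := fun _ => ℤˣ) n ⁻¹' {z} = {w | ∀ i ≤ n, w i = y i} := by
      ext w
      simp only [Set.mem_preimage, Set.mem_singleton_iff, Set.mem_ofPred_eq]
      constructor
      · rintro rfl i hi
        simp [y, hi]
      · intro hw
        ext ⟨i, hi⟩
        have := hw i (Finset.mem_Iic.1 hi)
        simp only [y, dif_pos (Finset.mem_Iic.1 hi)] at this
        simp [this]
    have hzm : MeasurableSet {w : ℕ → ℤˣ | ∀ i ≤ n, w i = y i} := by
      rw [← hz]
      exact (Preorder.measurable_frestrictLe n) (measurableSet_singleton z)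
    rw [Measure.map_apply (Preorder.measurable_frestrictLe n) (measurableSet_singleton z),
      Measure.map_apply (Preorder.measurable_frestrictLe n) (measurableSet_singleton z),
      hz, Measure.map_apply hYm hzm, Measure.map_apply hYm' hzm]
    exact hpath n y
  let Q : (I : Finset ℕ) → Measure (Π _ : I, ℤˣ) := fun I =>
    (μ'.map (fun ω n => Y' n ω)).map I.restrict
  have hQ : IsProjectiveMeasureFamily (α := fun _ => ℤˣ) Q := by
    intro I J hJI
    simp only [Q]
    rw [Measure.map_map (Finset.measurable_restrict₂ hJI) (Finset.measurable_restrict I)]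
    rfl
  exact ((isProjectiveLimit_nat_iff hQ _).2 hfin).unique fun I => rfl

/-- The two-state chain started at `y₀` that jumps at the renewal times of `F`. -/
def renewalChain {Ω : Type*} (y₀ : ℤˣ) (F : ℕ → Ω → ℕ) (n : ℕ) (ω : Ω) : ℤˣ :=
  y₀ * (-1) ^ renewalCount (fun k => F k ω) n

theorem measurable_renewalChain {Ω : Type*} [MeasurableSpace Ω] {F : ℕ → Ω → ℕ} (y₀ : ℤˣ)
    (hF : ∀ k, Measurable (F k)) (n : ℕ) : Measurable (renewalChain y₀ F n) :=
  (measurable_of_countable fun m : ℕ => y₀ * (-1) ^ m).comp (measurable_renewalCount hF n)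

/-- The `k`-th sojourn takes place in state `y₀ * (-1) ^ k`, whence the failure probabilities. A
path from `y₀` corresponds to a unique sequence of renewal counts. -/
theorem hasTransitions_renewalChain {Ω : Type*} [MeasurableSpace Ω] {P : Measure Ω}
    {F : ℕ → Ω → ℕ} {α β : ℝ} {ρ : ℤˣ → ℝ} (h0 : ρ (-1) = α) (h1 : ρ 1 = β) (y₀ : ℤˣ)
    (hF : IsGeometricSequence F (fun k => 1 - ρ (y₀ * (-1) ^ k)) P) :
    HasTransitions (renewalChain y₀ F) (transitionMatrix α β) P := by
  intro n y
  by_cases hy : y 0 = y₀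
  swap
  · have hempty : ∀ n, {ω | ∀ i ≤ n, renewalChain y₀ F i ω = y i} = ∅ := fun n =>
      Set.eq_empty_of_forall_notMem fun ω hω => hy <| by
        simpa [renewalChain, renewalCount_zero] using (hω 0 (Nat.zero_le n)).symm
    simp [hempty]
  -- `d` marks the sign changes of the path and `v` counts them.
  let d : ℕ → ℕ := fun i => if y (i + 1) = y i then 0 else 1
  let v : ℕ → ℕ := fun n => ∑ i ∈ Finset.range n, d i
  have hv : ∀ n, v (n + 1) = v n + d n := fun n => Finset.sum_range_succ _ _
  have hflip : ∀ i, y (i + 1) = y i * (-1) ^ d i := by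
    intro i
    simp only [d]
    split_ifs with h
    · simp [h]
    · simpa using (units_eq_or_neg _ _).resolve_left h
  have hyv : ∀ n, y n = y₀ * (-1) ^ v n := by
    intro n
    induction n with
    | zero => simp [v, hy]
    | succ n ih => rw [hflip, ih, hv, pow_add, mul_assoc]
  have hpath : ∀ n ω, (∀ i ≤ n, renewalChain y₀ F i ω = y i) ↔
      ∀ i ≤ n, renewalCount (fun k => F k ω) i = v i := by
    intro n ω
    refine ⟨fun h => ?_, fun h i hi => by rw [renewalChain, h i hi, hyv]⟩
    -- A sign only reveals the parity of the count, but each step adds at most one renewal, so the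
    -- counts are recovered inductively.
    intro i
    induction i with
    | zero => intro _; simp [v, renewalCount_zero]
    | succ i ih =>
      intro hi
      have hi' := ih (by omega)
      have h2 := h (i + 1) hi
      rw [renewalChain, renewalCount_succ, hi', hflip, hyv i, mul_assoc] at h2
      rw [renewalCount_succ, hi', hv]
      have h3 := mul_left_cancel h2
      by_cases hd : y (i + 1) = y i
      · simp only [d, if_pos hd] at h3 ⊢
        split_ifs at h3 ⊢
        · simp [pow_succ] at h3
        · rfl
      · simp only [d, if_neg hd] at h3 ⊢
        split_ifs at h3 ⊢
        · rfl
        · simp at h3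
  simp only [hpath]
  rw [hF.measure_path_succ (hv n)]
  congr 2
  rw [hflip n, ← hyv n]
  simp only [d]
  split_ifs with h
  · simp [flipProb, transitionMatrix_self h0 h1]
  · simp [flipProb, transitionMatrix_neg h0 h1]

/-! ### Measurability of the walk on path space -/

/-- Linear interpolation of sequences on a time grid of mesh `Δ`, as a map to path space. -/
noncomputable def interpPath (Δ : ℝ≥0) (x : ℕ → ℝ) : C(ℝ≥0, ℝ) where
  toFun s := linInterp x (s / Δ)
  continuous_toFun := (continuous_linInterp x).comp (by fun_prop)

/-- Locally in time the interpolation involves finitely many terms of the sequence, so it is jointly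
continuous. This makes the walk measurable as a path-valued map. -/
theorem continuous_interpPath (Δ : ℝ≥0) : Continuous (interpPath Δ) := by
  refine ContinuousMap.continuous_of_continuous_uncurry _ ?_
  rw [continuous_iff_continuousAt]
  rintro ⟨x, s⟩
  obtain ⟨N, hN⟩ := exists_nat_gt (s / Δ)
  have hc : Continuous fun v : (ℕ → ℝ) × ℝ≥0 => v.1 0 + ∑ i ∈ Finset.range N,
      (v.1 (i + 1) - v.1 i) * max 0 (min 1 (((v.2 / Δ : ℝ≥0) : ℝ) - i)) := by
    fun_prop
  refine hc.continuousAt.congr ?_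
  have ho : Continuous fun v : (ℕ → ℝ) × ℝ≥0 => v.2 / Δ := by fun_prop
  filter_upwards [ho.continuousAt.preimage_mem_nhds (Iio_mem_nhds hN)] with v hv
  rw [linInterp_aux, if_pos (Set.mem_Iio.1 hv)]
  rfl

/-- The interpolated walk as a function of the trajectory of the chain. -/
noncomputable def walkOfChain (Δ : ℝ≥0) (y : ℕ → ℤˣ) : C(ℝ≥0, ℝ) :=
  interpPath Δ fun n => Δ * ((∑ i ∈ Finset.range (n + 1), (y i : ℤ) : ℤ) : ℝ)

theorem measurable_walkOfChain (Δ : ℝ≥0) : Measurable (walkOfChain Δ) := by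
  refine (continuous_interpPath Δ).measurable.comp (measurable_pi_iff.2 fun n => ?_)
  refine (measurable_of_countable fun z : ℤ => (Δ * (z : ℝ) : ℝ)).comp ?_
  exact Finset.measurable_fun_sum _ fun i _ =>
    (measurable_of_countable fun u : ℤˣ => (u : ℤ)).comp (measurable_pi_apply i)

theorem scaledWalk_eq {Ω : Type*} (Δ : ℝ≥0) (Y : ℕ → Ω → ℤˣ) (ω : Ω) :
    scaledWalk Δ Δ Y ω = walkOfChain Δ fun n => Y n ω := rfl

theorem measurable_scaledWalk {Ω : Type*} [MeasurableSpace Ω] (Δ : ℝ≥0) {Y : ℕ → Ω → ℤˣ}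
    (hY : ∀ n, Measurable (Y n)) : Measurable (scaledWalk Δ Δ Y) :=
  (measurable_walkOfChain Δ).comp (measurable_pi_iff.2 hY)

/-! ### Exponential holding times -/

theorem expMeasure_one_Iic_zero : expMeasure 1 (Set.Iic 0) = 0 := by
  have := isProbabilityMeasure_expMeasure (zero_lt_one (α := ℝ))
  have h := cdf_expMeasure_eq zero_lt_one 0
  rw [cdf_eq_real] at h
  simpa [measureReal_def, ENNReal.toReal_eq_zero_iff] using h

theorem expMeasure_one_Ici {x : ℝ} (hx : 0 ≤ x) :
    expMeasure 1 (Set.Ici x) = ENNReal.ofReal (Real.exp (-x)) := by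
  have := isProbabilityMeasure_expMeasure (zero_lt_one (α := ℝ))
  have hac : expMeasure 1 ≪ volume := withDensity_absolutelyContinuous _ _
  have h := cdf_expMeasure_eq zero_lt_one x
  rw [cdf_eq_real, if_pos hx, one_mul] at h
  have h1 : expMeasure 1 (Set.Ici x) = expMeasure 1 (Set.Ioi x) :=
    measure_congr (hac.ae_le Ioi_ae_eq_Ici.symm)
  rw [h1, ← Set.compl_Iic, ← ofReal_measureReal, probReal_compl_eq_one_sub measurableSet_Iic, h]
  congr 1
  ring

/-- The event `r ≤ ⌊e / θ⌋₊` is `r * θ ≤ e`, of probability `exp (-θ) ^ r`. -/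
theorem isGeometricSequence_floor {Ω : Type*} [MeasurableSpace Ω] {e : ℕ → Ω → ℝ}
    {P : Measure Ω} (he : IsStdExpSequence e P) {θ : ℕ → ℝ} (hθ : ∀ k, 0 < θ k) :
    IsGeometricSequence (fun k ω => ⌊e k ω / θ k⌋₊) (fun k => Real.exp (-θ k)) P where
  measurable k := ((he.measurable k).div_const _).nat_floor
  indep := he.indep.comp (fun k x => ⌊x / θ k⌋₊) fun k => (measurable_id.div_const _).nat_floor
  nonneg k := (Real.exp_pos _).le
  le_one k := Real.exp_le_one_iff.2 (by linarith [hθ k])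
  tail k r := by
    have := he.indep.isProbabilityMeasure
    -- The case `r = 0` is separate because `e k` may be negative on a null set, where the floor is
    -- still `0`.
    rcases eq_or_ne r 0 with rfl | hr
    · simp
    have : {ω | r ≤ ⌊e k ω / θ k⌋₊} = e k ⁻¹' Set.Ici (r * θ k) := by
      ext ω
      simp only [Set.mem_ofPred_eq, Set.mem_preimage, Set.mem_Ici]
      rw [Nat.le_floor_iff' hr, le_div_iff₀ (hθ k)]
    rw [this, ← Measure.map_apply (he.measurable k) measurableSet_Ici, (he.law k).map_eq,
      expMeasure_one_Ici (mul_nonneg r.cast_nonneg (hθ k).le), ← Real.exp_nat_mul]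
    congr 2
    ring

/-- The sample points at which all holding times are positive and their sum diverges. -/
def IsRegularSample (x : ℕ → ℝ) : Prop :=
  (∀ k, 0 < x k) ∧ Tendsto (fun n => ∑ i ∈ Finset.range n, x i) atTop atTop

theorem tendsto_sum_atTop_of_frequently_one_le {x : ℕ → ℝ} (h0 : ∀ k, 0 ≤ x k)
    (h1 : ∃ᶠ k in atTop, 1 ≤ x k) :
    Tendsto (fun n => ∑ i ∈ Finset.range n, x i) atTop atTop := by
  have hmono : Monotone fun n => ∑ i ∈ Finset.range n, x i :=
    monotone_nat_of_le_succ fun n => by rw [Finset.sum_range_succ]; linarith [h0 n]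
  have hN : ∀ N : ℕ, ∃ n, (N : ℝ) ≤ ∑ i ∈ Finset.range n, x i := by
    intro N
    induction N with
    | zero => exact ⟨0, by simp⟩
    | succ N ih =>
      obtain ⟨n, hn⟩ := ih
      obtain ⟨k, hk, hk1⟩ := frequently_atTop.1 h1 n
      refine ⟨k + 1, ?_⟩
      rw [Finset.sum_range_succ]
      have := hmono hk
      simp only at this
      push_cast
      linarith
  refine tendsto_atTop_atTop_of_monotone hmono fun b => ?_
  obtain ⟨N, hb⟩ := exists_nat_ge b
  obtain ⟨n, hn⟩ := hN N
  exact ⟨n, hb.trans hn⟩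

/-- The independent events `1 ≤ e k` all have probability `exp (-1)`, so infinitely many occur by
the second Borel–Cantelli lemma and the sum diverges. -/
theorem IsStdExpSequence.ae_isRegularSample {Ω : Type*} [MeasurableSpace Ω] {e : ℕ → Ω → ℝ}
    {P : Measure Ω} (he : IsStdExpSequence e P) :
    ∀ᵐ ω ∂P, IsRegularSample fun k => e k ω := by
  have := he.indep.isProbabilityMeasure
  have hpos : ∀ᵐ ω ∂P, ∀ k, 0 < e k ω := by
    rw [ae_all_iff]
    intro k
    have h := expMeasure_one_Iic_zero
    rw [← (he.law k).map_eq, Measure.map_apply (he.measurable k) measurableSet_Iic] at h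
    filter_upwards [measure_eq_zero_iff_ae_notMem.1 h] with ω hω
    exact not_le.1 hω
  have hset : ∀ k, MeasurableSet (e k ⁻¹' Set.Ici 1) := fun k => he.measurable k measurableSet_Ici
  have hind : iIndepSet (fun k => e k ⁻¹' Set.Ici 1) P := by
    rw [iIndepSet_iff_meas_biInter hset]
    exact fun s => he.indep.measure_inter_preimage_eq_mul s fun _ _ => measurableSet_Ici
  have hlim := measure_limsup_eq_one hset hind <| by
    have : ∀ k, P (e k ⁻¹' Set.Ici 1) = ENNReal.ofReal (Real.exp (-1)) := fun k => by
      rw [← Measure.map_apply (he.measurable k) measurableSet_Ici, (he.law k).map_eq,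
        expMeasure_one_Ici zero_le_one]
    simp only [this]
    exact ENNReal.tsum_const_eq_top_of_ne_zero (by simp [Real.exp_pos])
  have hlim' : ∀ᵐ ω ∂P, ω ∈ limsup (fun k => e k ⁻¹' Set.Ici 1) atTop :=
    (mem_ae_iff_prob_eq_one (MeasurableSet.measurableSet_limsup hset)).2 hlim
  filter_upwards [hpos, hlim'] with ω h1 h2
  refine ⟨h1, tendsto_sum_atTop_of_frequently_one_le (fun k => (h1 k).le) ?_⟩
  exact mem_limsup_iff_frequently_mem.1 h2

/-! ### Jump times and the counting process -/

theorem holdingMean_pos {a b : ℝ≥0} (ha : 0 < a) (hb : 0 < b) (k : ℕ) :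
    0 < holdingMean a b k := by
  have ha' : (0 : ℝ) < a := ha
  have hb' : (0 : ℝ) < b := hb
  unfold holdingMean
  split_ifs <;> positivity

section Sample

variable {Ω : Type*} {a b : ℝ≥0} {e : ℕ → Ω → ℝ} {ω : Ω}

theorem jumpTime_strictMono (ha : 0 < a) (hb : 0 < b) (hω : IsRegularSample fun k => e k ω) :
    StrictMono fun k => jumpTime a b e k ω :=
  strictMono_nat_of_lt_succ fun k => by
    unfold jumpTime
    rw [Finset.sum_range_succ _ (k + 1)]
    linarith [mul_pos (holdingMean_pos ha hb (k + 1)) (hω.1 (k + 1))]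

theorem tendsto_jumpTime (ha : 0 < a) (hb : 0 < b) (hω : IsRegularSample fun k => e k ω) :
    Tendsto (fun k => jumpTime a b e k ω) atTop atTop := by
  have hc : 0 < min (1 / (a : ℝ)) (1 / b) :=
    lt_min (one_div_pos.2 (by exact_mod_cast ha)) (one_div_pos.2 (by exact_mod_cast hb))
  refine tendsto_atTop_mono (fun k => ?_)
    ((hω.2.comp (tendsto_add_atTop_nat 1)).const_mul_atTop hc)
  simp only [Function.comp_apply, jumpTime, Finset.mul_sum]
  refine Finset.sum_le_sum fun i _ => mul_le_mul_of_nonneg_right ?_ (hω.1 i).le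
  unfold holdingMean
  split_ifs
  · exact min_le_left _ _
  · exact min_le_right _ _

theorem exists_jumpTime_index (ha : 0 < a) (hb : 0 < b) (hω : IsRegularSample fun k => e k ω)
    (t : ℝ) : ∃ m, (∀ k < m, jumpTime a b e k ω ≤ t) ∧ t < jumpTime a b e m ω := by
  classical
  have h := ((tendsto_jumpTime ha hb hω).eventually_gt_atTop t).exists
  exact ⟨Nat.find h, fun k hk => not_lt.1 (Nat.find_min h hk), Nat.find_spec h⟩

theorem countingProcess_eq (ha : 0 < a) (hb : 0 < b) (hω : IsRegularSample fun k => e k ω)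
    {t : ℝ} {m : ℕ} (h1 : ∀ k < m, jumpTime a b e k ω ≤ t) (h2 : t < jumpTime a b e m ω) :
    countingProcess a b e t ω = m := by
  have : {k : ℕ | jumpTime a b e k ω ≤ t} = Finset.range m := by
    ext k
    simp only [Set.mem_ofPred_eq, Finset.coe_range, Set.mem_Iio]
    refine ⟨fun h => ?_, h1 k⟩
    by_contra! hk
    exact absurd ((jumpTime_strictMono ha hb hω).monotone hk) (not_le.2 (h.trans_lt h2))
  rw [countingProcess, this, Set.encard_coe_eq_coe_finsetCard, Finset.card_range]

theorem countingProcess_ne_top (ha : 0 < a) (hb : 0 < b) (hω : IsRegularSample fun k => e k ω)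
    (t : ℝ) : countingProcess a b e t ω ≠ ⊤ := by
  obtain ⟨m, h1, h2⟩ := exists_jumpTime_index ha hb hω t
  rw [countingProcess_eq ha hb hω h1 h2]
  exact ENat.natCast_ne_top m

/-! ### Convergence of the discrete renewals -/

variable {ι : Type*} {l : Filter ι} {Δ : ι → ℝ≥0} {θ : ι → ℕ → ℝ}

/-- Each term `⌊x / θ⌋₊ + 1` lies between `x / θ` and `x / θ + 1`, and the rounding error vanishes
after multiplication by `Δ`. -/
theorem tendsto_mul_renewalTime {x μ : ℕ → ℝ} (hx : ∀ k, 0 ≤ x k)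
    (hΔ : Tendsto (fun i => (Δ i : ℝ)) l (𝓝 0)) (hθ : ∀ k, ∀ᶠ i in l, 0 < θ i k)
    (hμ : ∀ k, Tendsto (fun i => Δ i / θ i k) l (𝓝 (μ k))) (m : ℕ) :
    Tendsto (fun i => (Δ i : ℝ) * renewalTime (fun k => ⌊x k / θ i k⌋₊) m) l
      (𝓝 (∑ k ∈ Finset.range m, μ k * x k)) := by
  simp only [renewalTime, Nat.cast_sum, Finset.mul_sum]
  refine tendsto_finsetSum _ fun k _ => ?_
  have h1 := (hμ k).mul_const (x k)
  have h2 := h1.add hΔ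
  rw [add_zero] at h2
  refine tendsto_of_tendsto_of_tendsto_of_le_of_le' h1 h2 ?_ ?_
  · filter_upwards with i
    have := (Nat.lt_floor_add_one (x k / θ i k)).le
    calc Δ i / θ i k * x k = Δ i * (x k / θ i k) := by ring
      _ ≤ _ := by push_cast; exact mul_le_mul_of_nonneg_left this (Δ i).2
  · filter_upwards [hθ k] with i hi
    have := Nat.floor_le (div_nonneg (hx k) hi.le)
    calc _ ≤ Δ i * (x k / θ i k + 1) := by
          push_cast; exact mul_le_mul_of_nonneg_left (by linarith) (Δ i).2
      _ = _ := by ring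

/-- The sign of the chain at index `⌊u / Δ⌋₊ + 1` is the velocity of the walk at time `u`. If `u` is
not a jump time, it lies strictly between the limits of two consecutive rescaled renewal times. -/
theorem eventually_renewalCount_eq (ha : 0 < a) (hb : 0 < b)
    (hω : IsRegularSample fun k => e k ω) (hΔ0 : ∀ i, 0 < Δ i)
    (hΔ : Tendsto (fun i => (Δ i : ℝ)) l (𝓝 0)) (hθ : ∀ k, ∀ᶠ i in l, 0 < θ i k)
    (hμ : ∀ k, Tendsto (fun i => Δ i / θ i k) l (𝓝 (holdingMean a b k)))
    {u : ℝ} (hu : 0 < u) (hJ : ∀ k, jumpTime a b e k ω ≠ u) :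
    ∀ᶠ i in l, renewalCount (fun k => ⌊e k ω / θ i k⌋₊) (⌊u / Δ i⌋₊ + 1) =
      (countingProcess a b e u ω).toNat := by
  obtain ⟨m, h1, h2⟩ := exists_jumpTime_index ha hb hω u
  rw [countingProcess_eq ha hb hω h1 h2, ENat.toNat_natCast]
  have hlim := tendsto_mul_renewalTime (fun k => (hω.1 k).le) hΔ hθ hμ
  have hn : Tendsto (fun i => (Δ i : ℝ) * ((⌊u / Δ i⌋₊ + 1 : ℕ) : ℝ)) l (𝓝 u) := by
    have h3 := hΔ.const_add u
    rw [add_zero] at h3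
    refine tendsto_of_tendsto_of_tendsto_of_le_of_le tendsto_const_nhds h3 (fun i => ?_)
      fun i => ?_
    · have hi : (0 : ℝ) < Δ i := hΔ0 i
      have := (Nat.lt_floor_add_one (u / Δ i)).le
      rw [div_le_iff₀ hi] at this
      push_cast
      linarith
    · have hi : (0 : ℝ) < Δ i := hΔ0 i
      have := Nat.floor_le (div_nonneg hu.le hi.le)
      rw [le_div_iff₀ hi] at this
      push_cast
      linarith
  have hlow : ∑ k ∈ Finset.range m, holdingMean a b k * e k ω < u := by
    cases m with
    | zero => simpa using hu
    | succ m => exact lt_of_le_of_ne (h1 m (Nat.lt_succ_self m)) (hJ m)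
  filter_upwards [(hlim m).eventually_lt hn hlow, hn.eventually_lt (hlim (m + 1)) h2]
    with i hi1 hi2
  have hi : (0 : ℝ) < Δ i := hΔ0 i
  rw [renewalCount_eq_iff]
  exact ⟨by exact_mod_cast (lt_of_mul_lt_mul_left hi1 hi.le).le,
    by exact_mod_cast lt_of_mul_lt_mul_left hi2 hi.le⟩

end Sample

/-! ### The walk as an integral -/

theorem measurable_floor_div (d : ℕ → ℝ) (c : ℝ) : Measurable fun u : ℝ => d ⌊u / c⌋₊ :=
  (measurable_of_countable d).comp (measurable_id.div_const c).nat_floor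

theorem intervalIntegrable_of_abs_le {f : ℝ → ℝ} (hf : Measurable f) {C : ℝ}
    (hC : ∀ u, |f u| ≤ C) (s t : ℝ) : IntervalIntegrable f volume s t :=
  (intervalIntegrable_const (c := C)).mono_fun hf.aestronglyMeasurable
    (Eventually.of_forall fun u => (hC u).trans (le_abs_self C))

/-- Integrating right derivatives suffices, and these exist even at the nodes. -/
theorem linInterp_eq_integral {x : ℕ → ℝ} {C : ℝ} (hC : ∀ n, |x (n + 1) - x n| ≤ C)
    (s : ℝ≥0) : linInterp x s = x 0 + ∫ u in (0 : ℝ)..s, (x (⌊u⌋₊ + 1) - x ⌊u⌋₊) := by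
  have hcont : Continuous fun v : ℝ => linInterp x v.toNNReal :=
    (continuous_linInterp x).comp continuous_real_toNNReal
  have hmeas : Measurable fun u : ℝ => x (⌊u⌋₊ + 1) - x ⌊u⌋₊ := by
    simpa using measurable_floor_div (fun n => x (n + 1) - x n) 1
  have h := intervalIntegral.integral_eq_sub_of_hasDeriv_right_of_le (a := 0) (b := s)
    (f := fun v : ℝ => linInterp x v.toNNReal) s.2 hcont.continuousOn
    (f' := fun u => x (⌊u⌋₊ + 1) - x ⌊u⌋₊) (fun v hv => ?_)
    (intervalIntegrable_of_abs_le hmeas (fun u => hC _) _ _)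
  · rw [h]
    simp [linInterp]
  · have hlin : HasDerivAt (fun u : ℝ => x ⌊v⌋₊ + (u - ⌊v⌋₊) * (x (⌊v⌋₊ + 1) - x ⌊v⌋₊))
        (x (⌊v⌋₊ + 1) - x ⌊v⌋₊) v := by
      simpa using (((hasDerivAt_id v).sub_const (⌊v⌋₊ : ℝ)).mul_const
        (x (⌊v⌋₊ + 1) - x ⌊v⌋₊)).const_add (x ⌊v⌋₊)
    have heq : ∀ u : ℝ, v ≤ u → u < ⌊v⌋₊ + 1 → linInterp x u.toNNReal =
        x ⌊v⌋₊ + (u - ⌊v⌋₊) * (x (⌊v⌋₊ + 1) - x ⌊v⌋₊) := by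
      intro u h1 h2
      have hu : 0 ≤ u := hv.1.le.trans h1
      have hf : ⌊u.toNNReal⌋₊ = ⌊v⌋₊ := by
        rw [Nat.floor_eq_iff zero_le]
        refine ⟨?_, ?_⟩
        · rw [← NNReal.coe_le_coe, Real.coe_toNNReal _ hu]
          exact (Nat.floor_le hv.1.le).trans h1
        · rw [← NNReal.coe_lt_coe, Real.coe_toNNReal _ hu]
          exact_mod_cast h2
      rw [linInterp, hf, Real.coe_toNNReal _ hu]
    refine hlin.hasDerivWithinAt.congr_of_eventuallyEq ?_ (heq v le_rfl (Nat.lt_floor_add_one v))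
    filter_upwards [self_mem_nhdsWithin,
      mem_nhdsWithin_of_mem_nhds (Iio_mem_nhds (Nat.lt_floor_add_one v))] with u h1 h2
    exact heq u (le_of_lt h1) h2

/-- Space and time have the same scale, so the slopes are `±1`. Because `X_0 = Y_0`, the path starts
at `Δ * y 0` and its velocity on the `n`-th interval is `y (n + 1)`. -/
theorem walkOfChain_apply {Δ : ℝ≥0} (hΔ : 0 < Δ) (y : ℕ → ℤˣ) (s : ℝ≥0) :
    walkOfChain Δ y s =
      Δ * ((y 0 : ℤ) : ℝ) + ∫ u in (0 : ℝ)..s, ((y (⌊u / Δ⌋₊ + 1) : ℤ) : ℝ) := by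
  have hΔ' : (0 : ℝ) < Δ := hΔ
  have hstep : ∀ n, (Δ : ℝ) * ((∑ i ∈ Finset.range (n + 1 + 1), (y i : ℤ) : ℤ) : ℝ) -
      Δ * ((∑ i ∈ Finset.range (n + 1), (y i : ℤ) : ℤ) : ℝ) =
        Δ * ((y (n + 1) : ℤ) : ℝ) := by
    intro n
    rw [Finset.sum_range_succ _ (n + 1)]
    push_cast
    ring
  have habs : ∀ u : ℤˣ, |((u : ℤ) : ℝ)| = 1 := fun u => by
    rcases Int.units_eq_one_or u with rfl | rfl <;> simp
  have hdef : walkOfChain Δ y s = linInterp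
      (fun n => Δ * ((∑ i ∈ Finset.range (n + 1), (y i : ℤ) : ℤ) : ℝ)) (s / Δ) := rfl
  rw [hdef, linInterp_eq_integral (C := Δ)]
  · simp only [hstep]
    rw [intervalIntegral.integral_const_mul]
    have := intervalIntegral.integral_comp_div
      (fun u : ℝ => ((y (⌊u⌋₊ + 1) : ℤ) : ℝ)) (a := 0) (b := s) hΔ'.ne'
    rw [this]
    simp
  · intro n
    rw [hstep, abs_mul, habs, mul_one, abs_of_pos hΔ']

theorem tendsto_scaledWalk_renewalChain {Ω ι : Type*} {a b : ℝ≥0} {e : ℕ → Ω → ℝ} {ω : Ω}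
    {l : Filter ι} [l.IsCountablyGenerated] {Δ : ι → ℝ≥0} {θ : ι → ℕ → ℝ}
    (ha : 0 < a) (hb : 0 < b)
    (hω : IsRegularSample fun k => e k ω) (hΔ0 : ∀ i, 0 < Δ i)
    (hΔ : Tendsto (fun i => (Δ i : ℝ)) l (𝓝 0)) (hθ : ∀ k, ∀ᶠ i in l, 0 < θ i k)
    (hμ : ∀ k, Tendsto (fun i => Δ i / θ i k) l (𝓝 (holdingMean a b k))) (y₀ : ℤˣ) :
    Tendsto (fun i => scaledWalk (Δ i) (Δ i)
      (renewalChain y₀ fun k ω => ⌊e k ω / θ i k⌋₊) ω) l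
      (𝓝 (((y₀ : ℤ) : ℝ) • itn a b e ω)) := by
  have habs : ∀ u : ℤˣ, |((u : ℤ) : ℝ)| = 1 := fun u => by
    rcases Int.units_eq_one_or u with rfl | rfl <;> simp
  set y : ι → ℕ → ℤˣ := fun i n => renewalChain y₀ (fun k ω => ⌊e k ω / θ i k⌋₊) n ω with hy
  let f : ι → ℝ → ℝ := fun i u => ((y i (⌊u / Δ i⌋₊ + 1) : ℤ) : ℝ)
  let g : ℝ → ℝ := fun u => ((y₀ : ℤ) : ℝ) * telegraphNoise a b e u ω
  have hfm : ∀ i, Measurable (f i) := fun i =>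
    measurable_floor_div (fun n => ((y i (n + 1) : ℤ) : ℝ)) _
  have hgm : Measurable g := (measurable_telegraphNoise a b e ω).const_mul _
  have hf1 : ∀ i u, |f i u| ≤ 1 := fun i u => (habs _).le
  have hg1 : ∀ u, |g u| ≤ 1 := fun u => by simp [g, abs_mul, habs, telegraphNoise]
  have hfi : ∀ i s t, IntervalIntegrable (f i) volume s t := fun i =>
    intervalIntegrable_of_abs_le (hfm i) (hf1 i)
  have hgi : ∀ s t, IntervalIntegrable g volume s t := intervalIntegrable_of_abs_le hgm hg1
  have hpt : ∀ u, 0 < u → (∀ k, jumpTime a b e k ω ≠ u) →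
      Tendsto (fun i => |f i u - g u|) l (𝓝 0) := by
    intro u hu hJ
    refine tendsto_const_nhds.congr' ?_
    filter_upwards [eventually_renewalCount_eq ha hb hω hΔ0 hΔ hθ hμ hu hJ] with i hi
    simp [f, g, hy, renewalChain, hi, telegraphNoise]
  have hint : ∀ T : ℝ, 0 ≤ T → Tendsto (fun i => ∫ u in (0 : ℝ)..T, |f i u - g u|) l (𝓝 0) := by
    intro T hT
    have := intervalIntegral.tendsto_integral_filter_of_dominated_convergence (a := 0) (b := T)
      (μ := volume) (l := l) (F := fun i u => |f i u - g u|) (f := fun _ => (0 : ℝ)) (fun _ => 2)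
      (Eventually.of_forall fun i => ((hfm i).sub hgm).abs.aestronglyMeasurable)
      (Eventually.of_forall fun i => Eventually.of_forall fun u _ => ?_)
      intervalIntegrable_const ?_
    · simpa using this
    · rw [Real.norm_eq_abs, abs_abs]
      exact (abs_sub _ _).trans (by linarith [hf1 i u, hg1 u])
    -- The exceptional times are countably many, hence null.
    · have hc : (Set.range fun k => jumpTime a b e k ω).Countable := Set.countable_range _
      filter_upwards [hc.ae_notMem volume] with u hu hmem
      rw [Set.uIoc_of_le hT] at hmem
      exact hpt u hmem.1 fun k hk => hu ⟨k, hk⟩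
  rw [ContinuousMap.tendsto_iff_forall_isCompact_tendstoUniformlyOn]
  intro K hK
  obtain ⟨T, hT⟩ := hK.bddAbove
  rw [Metric.tendstoUniformlyOn_iff]
  intro ε hε
  -- The initial offset plus the `L¹` distance of velocities on `[0, T]` bounds the distance of the
  -- paths at every `s ∈ K` simultaneously.
  have hsum := hΔ.add (hint T T.2)
  rw [add_zero] at hsum
  filter_upwards [hsum.eventually_lt_const hε] with i hi s hs
  refine lt_of_le_of_lt ?_ hi
  have hsT : (s : ℝ) ≤ T := by exact_mod_cast hT hs
  have hs0 : (0 : ℝ) ≤ s := s.2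
  have hdiff : scaledWalk (Δ i) (Δ i) (renewalChain y₀ fun k ω => ⌊e k ω / θ i k⌋₊) ω s -
      (((y₀ : ℤ) : ℝ) • itn a b e ω) s =
      Δ i * ((y i 0 : ℤ) : ℝ) + ∫ u in (0 : ℝ)..s, (f i u - g u) := by
    rw [scaledWalk_eq, walkOfChain_apply (hΔ0 i), intervalIntegral.integral_sub (hfi _ _ _) (hgi _ _)]
    simp only [g, intervalIntegral.integral_const_mul]
    simp [itn, f, hy]
    ring
  rw [dist_comm, Real.dist_eq, hdiff]
  refine (abs_add_le _ _).trans (add_le_add ?_ ?_)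
  · rw [abs_mul, habs, mul_one, NNReal.abs_eq]
  · refine (intervalIntegral.abs_integral_le_integral_abs hs0).trans ?_
    exact intervalIntegral.integral_mono_interval le_rfl hs0 hsT
      (Eventually.of_forall fun u => abs_nonneg _) ((hfi i _ _).sub (hgi _ _)).abs

/-! ### Convergence in distribution -/

/-- The denominator has derivative `r` at `0`. With `x = Δ` this identifies the limiting mean
holding times. -/
theorem tendsto_div_neg_log {r : ℝ} (hr : 0 < r) :
    Tendsto (fun x : ℝ => x / -Real.log (1 - x * r)) (𝓝[≠] 0) (𝓝 (1 / r)) := by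
  have h1 : HasDerivAt (fun x : ℝ => 1 - x * r) (-r) 0 := by
    simpa using ((hasDerivAt_id (0 : ℝ)).mul_const r).const_sub 1
  have h2 : HasDerivAt (fun x : ℝ => -Real.log (1 - x * r)) r 0 := by
    simpa using (h1.log (by simp)).fun_neg
  have h3 := (hasDerivAt_iff_tendsto_slope_zero.1 h2).inv₀ hr.ne'
  rw [one_div]
  refine h3.congr fun x => ?_
  simp [div_eq_mul_inv, mul_comm]

instance (c₀ c₁ : ℝ≥0) : (stepToZero c₀ c₁).IsCountablyGenerated := by
  unfold stepToZero; infer_instance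

theorem tendsto_stepToZero (c₀ c₁ : ℝ≥0) :
    Tendsto (fun Δ : StepSize c₀ c₁ => (Δ.1 : ℝ)) (stepToZero c₀ c₁) (𝓝[≠] 0) := by
  refine tendsto_nhdsWithin_iff.2 ⟨?_, Eventually.of_forall fun Δ => ?_⟩
  · exact (NNReal.continuous_coe.tendsto 0).comp tendsto_comap
  · exact Set.mem_compl_singleton_iff.2 (by exact_mod_cast Δ.2.1.ne')

/-- All sufficiently small positive steps are admissible. Nontriviality of the filter is what makes
an almost sure limit along it almost everywhere measurable. -/
instance (c₀ c₁ : ℝ≥0) : (stepToZero c₀ c₁).NeBot := by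
  refine comap_neBot fun s hs => ?_
  have hpos : 0 < (max c₀ c₁ + 1)⁻¹ := by positivity
  obtain ⟨x, hx0, hx⟩ : ∃ x : ℝ≥0, x ∈ s ∧ 0 < x ∧ x ≤ (max c₀ c₁ + 1)⁻¹ := by
    have h : s ∩ Set.Ioc 0 (max c₀ c₁ + 1)⁻¹ ∈ 𝓝[>] (0 : ℝ≥0) :=
      inter_mem (mem_nhdsWithin_of_mem_nhds hs) (Ioc_mem_nhdsGT hpos)
    obtain ⟨x, hx⟩ := nonempty_of_mem h
    exact ⟨x, hx⟩
  have hle : ∀ c ≤ max c₀ c₁, c * x ≤ 1 := fun c hc =>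
    (mul_le_mul' (hc.trans le_self_add) hx.2).trans (mul_inv_le_one)
  exact ⟨⟨x, hx.1, hle _ (le_max_left _ _), hle _ (le_max_right _ _)⟩, hx0⟩

/-- Both starting points are treated together: `hmean` says that the holding means `a`, `b` follow
the states visited from `y₀`. -/
theorem tendstoInDistribution_scaledWalk {c₀ c₁ : ℝ≥0} {a b : ℝ≥0} (ha : 0 < a) (hb : 0 < b)
    {ρ : ℤˣ → ℝ} (hρ : ∀ x, 0 < ρ x) (hρ₀ : ρ (-1) = c₀) (hρ₁ : ρ 1 = c₁) {y₀ : ℤˣ}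
    (hmean : ∀ k, holdingMean a b k = 1 / ρ (y₀ * (-1) ^ k))
    {Ω : StepSize c₀ c₁ → Type*} [∀ Δ, MeasurableSpace (Ω Δ)]
    (μ : ∀ Δ, Measure (Ω Δ)) [∀ Δ, IsProbabilityMeasure (μ Δ)]
    (Y : ∀ Δ, ℕ → Ω Δ → ℤˣ)
    (hY : ∀ Δ : StepSize c₀ c₁,
      IsMarkovChain (Y Δ) (transitionMatrix (c₀ * Δ.1) (c₁ * Δ.1)) (μ Δ))
    {Ω' : Type*} [MeasurableSpace Ω'] (P : Measure Ω') [IsProbabilityMeasure P]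
    (e : ℕ → Ω' → ℝ) (he : IsStdExpSequence e P) (h0 : ∀ Δ, ∀ᵐ ω ∂(μ Δ), Y Δ 0 ω = y₀) :
    TendstoInDistribution (fun Δ => scaledWalk Δ.1 Δ.1 (Y Δ)) (stepToZero c₀ c₁)
      (fun ω => ((y₀ : ℤ) : ℝ) • itn a b e ω) μ P := by
  let θ : StepSize c₀ c₁ → ℕ → ℝ := fun Δ k => -Real.log (1 - Δ.1 * ρ (y₀ * (-1) ^ k))
  let F : StepSize c₀ c₁ → ℕ → Ω' → ℕ := fun Δ k ω => ⌊e k ω / θ Δ k⌋₊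
  have hFm : ∀ Δ k, Measurable (F Δ k) := fun Δ k =>
    ((he.measurable k).div_const _).nat_floor
  have hΔ := tendsto_stepToZero c₀ c₁
  have hsmall : ∀ x, ∀ᶠ Δ : StepSize c₀ c₁ in stepToZero c₀ c₁,
      0 < Δ.1 * ρ x ∧ Δ.1 * ρ x < 1 := by
    intro x
    have h := (hΔ.mono_right nhdsWithin_le_nhds).mul_const (ρ x)
    rw [zero_mul] at h
    filter_upwards [h.eventually_lt_const one_pos] with Δ h1
    exact ⟨mul_pos (by exact_mod_cast Δ.2.1) (hρ x), h1⟩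
  -- Strict inequality is needed, since at `Δ * ρ x = 1` the logarithm degenerates; the coupling is
  -- therefore only claimed eventually.
  have hsmall' : ∀ᶠ Δ : StepSize c₀ c₁ in stepToZero c₀ c₁,
      ∀ x, 0 < Δ.1 * ρ x ∧ Δ.1 * ρ x < 1 := eventually_all.2 hsmall
  have hθpos : ∀ Δ : StepSize c₀ c₁, (∀ x, 0 < Δ.1 * ρ x ∧ Δ.1 * ρ x < 1) → ∀ k, 0 < θ Δ k :=
    fun Δ h k => neg_pos.2 (Real.log_neg (by linarith [(h (y₀ * (-1) ^ k)).2])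
      (by linarith [(h (y₀ * (-1) ^ k)).1]))
  have hconv : ∀ᵐ ω ∂P, Tendsto (fun Δ : StepSize c₀ c₁ =>
      scaledWalk Δ.1 Δ.1 (renewalChain y₀ (F Δ)) ω) (stepToZero c₀ c₁)
      (𝓝 (((y₀ : ℤ) : ℝ) • itn a b e ω)) := by
    filter_upwards [he.ae_isRegularSample] with ω hω
    refine tendsto_scaledWalk_renewalChain ha hb hω (fun Δ => Δ.2.1)
      (hΔ.mono_right nhdsWithin_le_nhds) (fun k => ?_) (fun k => ?_) y₀
    · filter_upwards [hsmall'] with Δ h using hθpos Δ h k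
    · rw [hmean]
      exact (tendsto_div_neg_log (hρ _)).comp hΔ
  have hm : ∀ Δ : StepSize c₀ c₁, Measurable (scaledWalk Δ.1 Δ.1 (Y Δ)) := fun Δ =>
    measurable_scaledWalk _ (hY Δ).measurable
  have hm' : ∀ Δ : StepSize c₀ c₁, Measurable (scaledWalk Δ.1 Δ.1 (renewalChain y₀ (F Δ))) :=
    fun Δ => measurable_scaledWalk _ (measurable_renewalChain y₀ (hFm Δ))
  have hlaw : ∀ᶠ Δ : StepSize c₀ c₁ in stepToZero c₀ c₁,
      (μ Δ).map (scaledWalk Δ.1 Δ.1 (Y Δ)) =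
        P.map (scaledWalk Δ.1 Δ.1 (renewalChain y₀ (F Δ))) := by
    filter_upwards [hsmall'] with Δ h
    have hgeo : IsGeometricSequence (F Δ) (fun k => 1 - ρ (y₀ * (-1) ^ k) * Δ.1) P := by
      have := isGeometricSequence_floor he (hθpos Δ h)
      convert! this using 2 with k
      simp only [θ, neg_neg]
      rw [Real.exp_log (by linarith [(h (y₀ * (-1) ^ k)).2]), mul_comm]
    have htr : HasTransitions (renewalChain y₀ (F Δ))
        (transitionMatrix (c₀ * Δ.1) (c₁ * Δ.1)) P :=
      hasTransitions_renewalChain (ρ := fun x => ρ x * Δ.1) (by rw [hρ₀]) (by rw [hρ₁]) y₀ hgeo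
    have hpath := (hY Δ).hasTransitions.map_eq htr (hY Δ).measurable
      (measurable_renewalChain y₀ (hFm Δ)) fun x => by
        have hstart : ∀ ω, renewalChain y₀ (F Δ) 0 ω = y₀ := fun ω => by
          simp [renewalChain, renewalCount_zero]
        simp only [hstart]
        rw [show μ Δ {ω | Y Δ 0 ω = x} = μ Δ {_ω | y₀ = x} from
          measure_congr (by filter_upwards [h0 Δ] with ω hω; exact congrArg (· = x) hω)]
        by_cases hx : y₀ = x <;> simp [hx]
    have hcomp := congrArg (Measure.map (walkOfChain Δ.1)) hpath
    rwa [Measure.map_map (measurable_walkOfChain _) (measurable_pi_iff.2 (hY Δ).measurable),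
      Measure.map_map (measurable_walkOfChain _)
        (measurable_pi_iff.2 (measurable_renewalChain y₀ (hFm Δ)))] at hcomp
  have hlim : AEMeasurable (fun ω => ((y₀ : ℤ) : ℝ) • itn a b e ω) P :=
    aemeasurable_of_tendsto_metrizable_ae _ (fun Δ => (hm' Δ).aemeasurable) hconv
  refine ⟨fun Δ => (hm Δ).aemeasurable, hlim, ?_⟩
  refine ProbabilityMeasure.tendsto_iff_forall_integral_tendsto.2 fun f => ?_
  have hint : Tendsto (fun Δ : StepSize c₀ c₁ =>
      ∫ ω, f (scaledWalk Δ.1 Δ.1 (renewalChain y₀ (F Δ)) ω) ∂P) (stepToZero c₀ c₁)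
      (𝓝 (∫ ω, f (((y₀ : ℤ) : ℝ) • itn a b e ω) ∂P)) := by
    refine tendsto_integral_filter_of_dominated_convergence (fun _ => ‖f‖)
      (Eventually.of_forall fun Δ =>
        (f.continuous.measurable.comp (hm' Δ)).aestronglyMeasurable)
      (Eventually.of_forall fun Δ => Eventually.of_forall fun ω => f.norm_coe_le_norm _)
      (integrable_const _) ?_
    filter_upwards [hconv] with ω hω using (f.continuous.tendsto _).comp hω
  simp only [ProbabilityMeasure.coe_mk]
  rw [integral_map hlim f.continuous.measurable.aestronglyMeasurable]
  refine hint.congr' ?_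
  filter_upwards [hlaw] with Δ h
  rw [h, integral_map (hm' Δ).aemeasurable f.continuous.measurable.aestronglyMeasurable]

/-! ### Flips of the symmetric chain -/

/-- The Bernoulli law on `ℕ` with success probability `1 - a`. -/
noncomputable def flipLaw (a : ℝ) : Measure ℕ :=
  ENNReal.ofReal a • Measure.dirac 0 + ENNReal.ofReal (1 - a) • Measure.dirac 1

instance (a : ℝ) : IsFiniteMeasure (flipLaw a) := by
  constructor
  simp [flipLaw]

theorem flipLaw_singleton (a : ℝ) (j : ℕ) : flipLaw a {j} = ENNReal.ofReal (flipProb a j) := by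
  rw [flipLaw, flipProb]
  by_cases h0 : j = 0
  · simp [h0]
  by_cases h1 : j = 1
  · simp [h1]
  · simp [h0, h1, Ne.symm h0, Ne.symm h1]

theorem integral_flipLaw {a : ℝ} (h0 : 0 ≤ a) (h1 : a ≤ 1) (f : ℕ → ℂ) :
    ∫ j, f j ∂flipLaw a = a * f 0 + (1 - a) * f 1 := by
  have hi : ∀ (r : ℝ) (j : ℕ), Integrable f (ENNReal.ofReal r • Measure.dirac j) := fun r j =>
    (integrable_dirac (by simp)).smul_measure ENNReal.ofReal_ne_top
  rw [flipLaw, integral_add_measure (hi _ _) (hi _ _), integral_smul_measure,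
    integral_smul_measure, integral_dirac, integral_dirac, ENNReal.toReal_ofReal h0,
    ENNReal.toReal_ofReal (by linarith)]
  simp

theorem renewalCount_mono (F : ℕ → ℕ) : Monotone (renewalCount F) :=
  monotone_nat_of_le_succ fun n => by
    rw [renewalCount_succ]
    split_ifs <;> omega

section Flips

variable {Ω : Type*} [MeasurableSpace Ω] {F : ℕ → Ω → ℕ} {a : ℝ} {P : Measure Ω}

/-- Prescribing the flips is prescribing a path of the count, and its probability factorizes by
`measure_path_succ` because the failure probability is constant. -/
theorem IsGeometricSequence.map_flips (hF : IsGeometricSequence F (fun _ => a) P) (n : ℕ) :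
    P.map (fun ω (i : Fin n) => renewalCount (fun k => F k ω) (i + 1) -
      renewalCount (fun k => F k ω) i) = Measure.pi fun _ => flipLaw a := by
  have := hF.indep.isProbabilityMeasure
  have hM := measurable_renewalCount hF.measurable
  have hMd : Measurable fun ω (i : Fin n) => renewalCount (fun k => F k ω) (i + 1) -
      renewalCount (fun k => F k ω) i := measurable_pi_iff.2 fun i => (hM _).sub (hM _)
  refine Measure.ext_of_singleton fun z => ?_
  rw [Measure.map_apply hMd (measurableSet_singleton z),
    Measure.pi_singleton]
  let z' : ℕ → ℕ := fun i => if hi : i < n then z ⟨i, hi⟩ else 0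
  let v : ℕ → ℕ := fun k => ∑ i ∈ Finset.range k, z' i
  have hv : ∀ k, v (k + 1) = v k + z' k := fun k => Finset.sum_range_succ _ _
  have hset : (fun ω (i : Fin n) => renewalCount (fun k => F k ω) (i + 1) -
      renewalCount (fun k => F k ω) i) ⁻¹' {z} =
      {ω | ∀ i ≤ n, renewalCount (fun k => F k ω) i = v i} := by
    ext ω
    simp only [Set.mem_preimage, Set.mem_singleton_iff, Set.mem_ofPred_eq, funext_iff]
    constructor
    · intro h i
      induction i with
      | zero => intro _; simp [v, renewalCount_zero]
      | succ i ih =>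
        intro hi
        have h1 := h ⟨i, hi⟩
        have h2 := renewalCount_mono (fun k => F k ω) (Nat.le_add_right i 1)
        have h3 : z' i = z ⟨i, hi⟩ := dif_pos hi
        simp only at h1
        rw [hv, ← ih (by omega), h3, ← h1]
        omega
    · rintro h ⟨i, hi⟩
      have h3 : z' i = z ⟨i, hi⟩ := dif_pos hi
      simp only
      rw [h i hi.le, h (i + 1) hi, hv, ← h3]
      omega
  have hprob : ∀ k, P {ω | ∀ i ≤ k, renewalCount (fun k => F k ω) i = v i} =
      ∏ i ∈ Finset.range k, ENNReal.ofReal (flipProb a (z' i)) := by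
    intro k
    induction k with
    | zero => simp [v, renewalCount_zero]
    | succ k ih => rw [hF.measure_path_succ (hv k), ih, Finset.prod_range_succ]
  rw [hset, hprob, Finset.prod_range]
  refine Finset.prod_congr rfl fun i _ => ?_
  rw [flipLaw_singleton]
  simp [z']

theorem IsGeometricSequence.integral_prod_pow_flips
    (hF : IsGeometricSequence F (fun _ => a) P) (z : ℕ → ℂ) (n : ℕ) :
    ∫ ω, ∏ i ∈ Finset.range n, z i ^ (renewalCount (fun k => F k ω) (i + 1) -
      renewalCount (fun k => F k ω) i) ∂P = ∏ i ∈ Finset.range n, (a + (1 - a) * z i) := by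
  have hM := measurable_renewalCount hF.measurable
  have h := integral_map (μ := P) (φ := fun ω (i : Fin n) =>
      renewalCount (fun k => F k ω) (i + 1) - renewalCount (fun k => F k ω) i)
    (measurable_pi_iff.2 fun i => (hM _).sub (hM _)).aemeasurable
    (f := fun x : Fin n → ℕ => ∏ i : Fin n, z i ^ x i)
    (measurable_of_countable _).aestronglyMeasurable
  rw [hF.map_flips, integral_fintype_prod_eq_prod (fun (i : Fin n) (j : ℕ) => z i ^ j)] at h
  simp only [integral_flipLaw (hF.nonneg 0) (hF.le_one 0), pow_zero, pow_one, mul_one] at h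
  simp only [Finset.prod_range]
  exact h.symm

theorem prod_range_eq_prod_blocks {n : ℕ → ℕ} (hn : Monotone n) (φ : ℕ → ℂ) (k : ℕ) :
    ∏ i ∈ Finset.range (n k), φ i = (∏ i ∈ Finset.range (n 0), φ i) *
      ∏ j ∈ Finset.range k, ∏ i ∈ Finset.Ico (n j) (n (j + 1)), φ i := by
  induction k with
  | zero => simp
  | succ k ih =>
    rw [Finset.prod_range_succ, ← mul_assoc, ← ih,
      Finset.prod_range_mul_prod_Ico _ (hn (Nat.le_succ k))]

/-- Bases constant on time blocks turn a product over single flips into a product over block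
increments; the base `1` discards everything before `n 0`. -/
theorem exists_blockwise_const {n : ℕ → ℕ} (hn : Monotone n) (w : ℕ → ℂ) (k : ℕ) :
    ∃ z : ℕ → ℂ, (∀ i < n 0, z i = 1) ∧
      ∀ j < k, ∀ i ∈ Finset.Ico (n j) (n (j + 1)), z i = w j := by
  induction k with
  | zero => exact ⟨fun _ => 1, fun _ _ => rfl, fun j hj => absurd hj (Nat.not_lt_zero j)⟩
  | succ k ih =>
    obtain ⟨z, h0, h1⟩ := ih
    refine ⟨fun i => if i < n k then z i else w k, fun i hi => ?_, fun j hj i hi => ?_⟩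
    · simp only
      rw [if_pos (hi.trans_le (hn (Nat.zero_le k))), h0 i hi]
    · rw [Finset.mem_Ico] at hi
      simp only
      rcases Nat.lt_or_ge j k with hjk | hjk
      · rw [if_pos (hi.2.trans_le (hn hjk)), h1 j hjk i (Finset.mem_Ico.2 hi)]
      · obtain rfl : j = k := by omega
        rw [if_neg (by omega)]

theorem sum_Ico_tsub {f : ℕ → ℕ} (hf : Monotone f) {m n : ℕ} (h : m ≤ n) :
    ∑ i ∈ Finset.Ico m n, (f (i + 1) - f i) = f n - f m := by
  induction n, h using Nat.le_induction with
  | base => simp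
  | succ n hmn ih =>
    rw [Finset.sum_Ico_succ_top hmn, ih]
    have h1 := hf hmn
    have h2 := hf (Nat.le_add_right n 1)
    omega

theorem IsGeometricSequence.integral_prod_pow_increments
    (hF : IsGeometricSequence F (fun _ => a) P) (w : ℕ → ℂ) {n : ℕ → ℕ} (hn : Monotone n)
    (k : ℕ) :
    ∫ ω, ∏ j ∈ Finset.range k, w j ^ (renewalCount (fun k => F k ω) (n (j + 1)) -
      renewalCount (fun k => F k ω) (n j)) ∂P =
      ∏ j ∈ Finset.range k, (a + (1 - a) * w j) ^ (n (j + 1) - n j) := by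
  obtain ⟨z, hz0, hz⟩ := exists_blockwise_const hn w k
  have h := hF.integral_prod_pow_flips z (n k)
  have hlhs : ∀ ω, ∏ i ∈ Finset.range (n k), z i ^ (renewalCount (fun k => F k ω) (i + 1) -
      renewalCount (fun k => F k ω) i) =
      ∏ j ∈ Finset.range k, w j ^ (renewalCount (fun k => F k ω) (n (j + 1)) -
        renewalCount (fun k => F k ω) (n j)) := by
    intro ω
    rw [prod_range_eq_prod_blocks hn, Finset.prod_eq_one, one_mul]
    · refine Finset.prod_congr rfl fun j hj => ?_
      rw [← sum_Ico_tsub (renewalCount_mono _) (hn (Nat.le_add_right j 1)),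
        ← Finset.prod_pow_eq_pow_sum]
      exact Finset.prod_congr rfl fun i hi => by rw [hz j (Finset.mem_range.1 hj) i hi]
    · exact fun i hi => by rw [hz0 i (Finset.mem_range.1 hi), one_pow]
  simp only [hlhs] at h
  rw [h, prod_range_eq_prod_blocks hn, Finset.prod_eq_one, one_mul]
  · refine Finset.prod_congr rfl fun j hj => ?_
    rw [Finset.prod_congr rfl fun i hi => by rw [hz j (Finset.mem_range.1 hj) i hi],
      Finset.prod_const, Nat.card_Ico]
  · exact fun i hi => by rw [hz0 i (Finset.mem_range.1 hi)]; ring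

end Flips

/-- If `g → 0` and `n g → τ` then `(1 + g) ^ n → exp τ`. -/
theorem tendsto_one_add_pow_cexp {ι : Type*} {l : Filter ι} {g : ι → ℂ} {n : ι → ℕ} {τ : ℂ}
    (hg : Tendsto g l (𝓝 0)) (hn : Tendsto (fun i => n i * g i) l (𝓝 τ)) :
    Tendsto (fun i => (1 + g i) ^ n i) l (𝓝 (Complex.exp τ)) := by
  have hd : HasDerivAt (fun z : ℂ => Complex.log (1 + z)) 1 0 := by
    simpa using ((hasDerivAt_id (0 : ℂ)).const_add 1).clog (by simp)
  have hs : Tendsto (dslope (fun z : ℂ => Complex.log (1 + z)) 0) (𝓝 0) (𝓝 1) := by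
    have := (continuousAt_dslope_same.2 hd.differentiableAt).tendsto
    rwa [dslope_same, hd.deriv] at this
  have hlog : Tendsto (fun i => n i * Complex.log (1 + g i)) l (𝓝 τ) := by
    have h := hn.mul (hs.comp hg)
    rw [mul_one] at h
    refine h.congr fun i => ?_
    have := sub_smul_dslope (fun z : ℂ => Complex.log (1 + z)) 0 (g i)
    simp only [sub_zero, smul_eq_mul, add_zero, Complex.log_one] at this
    rw [← this, mul_assoc]
    rfl
  refine ((Complex.continuous_exp.tendsto _).comp hlog).congr' ?_
  have hne : ∀ᶠ i in l, g i ≠ -1 := hg.eventually_ne (by simp)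
  filter_upwards [hne] with i hi
  have h1 : 1 + g i ≠ 0 := fun h => hi (by linear_combination h)
  simp only [Function.comp_apply]
  rw [Complex.exp_nat_mul, Complex.exp_log h1]

/-! ### The Poisson process -/

/-- The time-grid index used at resolution `1 / (l + 1) ^ 2`, shifted by a vanishing amount of
time so that renewals at time `t` are counted in the limit. -/
noncomputable def gridIndex (t : ℝ≥0) (l : ℕ) : ℕ := ⌈(t : ℝ) * ((l : ℝ) + 1) ^ 2⌉₊ + (l + 1)

/-- The geometric approximation of the `k`-th holding time of the rate `c` process at resolution
`1 / (l + 1) ^ 2`. -/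
noncomputable def gridHolding {Ω : Type*} (c : ℝ≥0) (e : ℕ → Ω → ℝ) (l k : ℕ) (ω : Ω) : ℕ :=
  ⌊e k ω / (c / ((l : ℝ) + 1) ^ 2)⌋₊

theorem gridIndex_mono (l : ℕ) {s t : ℝ≥0} (h : s ≤ t) : gridIndex s l ≤ gridIndex t l := by
  have : (s : ℝ) ≤ t := h
  unfold gridIndex
  gcongr

theorem holdingMean_self (c : ℝ≥0) (k : ℕ) : holdingMean c c k = 1 / c := by
  simp [holdingMean]

/-- Here jump times are allowed. The shift by `l + 1` grid steps eventually exceeds the rounding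
error of at most `m` steps accumulated by `m` holding times, yet it amounts to a time `1 / (l + 1)`,
too short to reach the next renewal. -/
theorem eventually_renewalCount_gridHolding {Ω : Type*} {c : ℝ≥0} (hc : 0 < c)
    {e : ℕ → Ω → ℝ} {ω : Ω} (hω : IsRegularSample fun k => e k ω) (t : ℝ≥0) :
    ∀ᶠ l in atTop, renewalCount (fun k => gridHolding c e l k ω) (gridIndex t l) =
      (countingProcess c c e t ω).toNat := by
  have hc' : (0 : ℝ) < c := hc
  obtain ⟨m, h1, h2⟩ := exists_jumpTime_index hc hc hω t
  rw [countingProcess_eq hc hc hω h1 h2, ENat.toNat_natCast]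
  have hdiv : ∀ (l k : ℕ), e k ω / (c / ((l : ℝ) + 1) ^ 2) = 1 / c * e k ω * ((l : ℝ) + 1) ^ 2 :=
    fun l k => by field_simp
  have hupper : ∀ l : ℕ, ((renewalTime (fun k => gridHolding c e l k ω) m : ℕ) : ℝ) ≤
      t * ((l : ℝ) + 1) ^ 2 + m := by
    intro l
    have hsum : ∑ k ∈ Finset.range m, 1 / (c : ℝ) * e k ω ≤ t := by
      cases m with
      | zero => simp
      | succ m => simpa [jumpTime, holdingMean_self] using h1 m (Nat.lt_succ_self m)
    calc ((renewalTime (fun k => gridHolding c e l k ω) m : ℕ) : ℝ)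
        ≤ ∑ k ∈ Finset.range m, (1 / c * e k ω * ((l : ℝ) + 1) ^ 2 + 1) := by
          rw [renewalTime, Nat.cast_sum]
          refine Finset.sum_le_sum fun k _ => ?_
          have hek := (hω.1 k).le
          have := Nat.floor_le (show 0 ≤ e k ω / (c / ((l : ℝ) + 1) ^ 2) by positivity)
          rw [hdiv] at this
          push_cast
          rw [gridHolding, hdiv]
          linarith
      _ = (∑ k ∈ Finset.range m, 1 / c * e k ω) * ((l : ℝ) + 1) ^ 2 + m := by
          rw [Finset.sum_add_distrib, Finset.sum_mul]; simp
      _ ≤ _ := by gcongr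
  have hlower : ∀ l : ℕ, jumpTime c c e m ω * ((l : ℝ) + 1) ^ 2 ≤
      ((renewalTime (fun k => gridHolding c e l k ω) (m + 1) : ℕ) : ℝ) := by
    intro l
    rw [renewalTime, Nat.cast_sum, jumpTime, Finset.sum_mul]
    refine Finset.sum_le_sum fun k _ => ?_
    have := (Nat.lt_floor_add_one (e k ω / (c / ((l : ℝ) + 1) ^ 2))).le
    rw [holdingMean_self, gridHolding, ← hdiv]
    push_cast
    exact this
  -- With `J` the next jump time, this gives `(J - t) * (l + 1) ^ 2 > 2 * (l + 1) ≥ l + 2`, which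
  -- absorbs the shift and the ceiling.
  have hgap : ∀ᶠ l : ℕ in atTop, 2 / (jumpTime c c e m ω - t) < (l : ℝ) :=
    tendsto_natCast_atTop_atTop.eventually_gt_atTop _
  filter_upwards [hgap, eventually_ge_atTop m] with l hl1 hl2
  rw [renewalCount_eq_iff]
  constructor
  · have hm : (m : ℝ) ≤ l := by exact_mod_cast hl2
    have := Nat.le_ceil ((t : ℝ) * ((l : ℝ) + 1) ^ 2)
    have h3 := hupper l
    have h4 : ((renewalTime (fun k => gridHolding c e l k ω) m : ℕ) : ℝ) ≤ gridIndex t l := by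
      rw [gridIndex]
      push_cast
      linarith
    exact_mod_cast h4
  · rw [div_lt_iff₀ (by linarith)] at hl1
    have hceil := Nat.ceil_lt_add_one (show 0 ≤ (t : ℝ) * ((l : ℝ) + 1) ^ 2 by positivity)
    have h3 := hlower l
    have h4 : (gridIndex t l : ℝ) <
        (renewalTime (fun k => gridHolding c e l k ω) (m + 1) : ℕ) := by
      refine lt_of_lt_of_le ?_ h3
      rw [gridIndex]
      push_cast
      have hl0 : (0 : ℝ) ≤ l := l.cast_nonneg
      nlinarith
    exact_mod_cast h4

theorem isGeometricSequence_gridHolding {Ω : Type*} [MeasurableSpace Ω] {c : ℝ≥0} (hc : 0 < c)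
    {e : ℕ → Ω → ℝ} {P : Measure Ω} (he : IsStdExpSequence e P) (l : ℕ) :
    IsGeometricSequence (gridHolding c e l) (fun _ => Real.exp (-(c / ((l : ℝ) + 1) ^ 2))) P :=
  have hc' : (0 : ℝ) < c := hc
  isGeometricSequence_floor he fun _ => by positivity

/-- The base is `1 + (1 - exp (-c / N)) * (w - 1)` with `N = (l + 1) ^ 2`, and the exponent is
asymptotic to `(t - s) * N` when `s < t`; the grid shifts cancel in the difference. -/
theorem tendsto_flip_transform (c : ℝ≥0) {s t : ℝ≥0} (hst : s ≤ t) (w : ℂ) :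
    Tendsto (fun l : ℕ => (((Real.exp (-(c / ((l : ℝ) + 1) ^ 2)) : ℝ) : ℂ) +
      (1 - ((Real.exp (-(c / ((l : ℝ) + 1) ^ 2)) : ℝ) : ℂ)) * w) ^
        (gridIndex t l - gridIndex s l)) atTop
      (𝓝 (Complex.exp ((c * (t - s) : ℝ≥0) * (w - 1)))) := by
  let N : ℕ → ℝ := fun l => ((l : ℝ) + 1) ^ 2
  have hN : Tendsto N atTop atTop :=
    (tendsto_pow_atTop two_ne_zero).comp
      (tendsto_atTop_add_const_right _ _ tendsto_natCast_atTop_atTop)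
  have hNpos : ∀ l, 0 < N l := fun l => by positivity
  have hexp : Tendsto (fun l => N l * (1 - Real.exp (-(c / N l)))) atTop (𝓝 (c : ℝ)) := by
    have hd : HasDerivAt (fun x : ℝ => 1 - Real.exp (-(c * x))) c 0 := by
      have h1 : HasDerivAt (fun x : ℝ => -(c * x)) (-(c : ℝ)) 0 := by
        simpa using ((hasDerivAt_id (0 : ℝ)).const_mul (c : ℝ)).fun_neg
      simpa using h1.exp.const_sub 1
    have hinv : Tendsto (fun l => (N l)⁻¹) atTop (𝓝[≠] 0) :=
      tendsto_nhdsWithin_iff.2 ⟨tendsto_inv_atTop_zero.comp hN,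
        Eventually.of_forall fun l => (inv_pos.2 (hNpos l)).ne'⟩
    refine ((hasDerivAt_iff_tendsto_slope_zero.1 hd).comp hinv).congr fun l => ?_
    simp [div_eq_mul_inv]
  have hceil : ∀ r : ℝ≥0, Tendsto (fun l => (⌈(r : ℝ) * N l⌉₊ : ℝ) / N l) atTop (𝓝 (r : ℝ)) :=
    fun r => (tendsto_nat_ceil_mul_div_atTop r.2).comp hN
  have hlen : ∀ l, ((gridIndex t l - gridIndex s l : ℕ) : ℝ) =
      ⌈(t : ℝ) * N l⌉₊ - ⌈(s : ℝ) * N l⌉₊ := by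
    intro l
    rw [Nat.cast_sub (gridIndex_mono l hst), gridIndex, gridIndex]
    push_cast
    ring
  have hprod : Tendsto (fun l => ((gridIndex t l - gridIndex s l : ℕ) : ℝ) *
      (1 - Real.exp (-(c / N l)))) atTop (𝓝 ((c * (t - s) : ℝ≥0) : ℝ)) := by
    have h := ((hceil t).sub (hceil s)).mul hexp
    have hval : ((c * (t - s) : ℝ≥0) : ℝ) = (t - s) * c := by
      rw [NNReal.coe_mul, NNReal.coe_sub hst, mul_comm]
    rw [hval]
    refine h.congr fun l => ?_
    rw [hlen]
    have := (hNpos l).ne'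
    field_simp
  have hzero : Tendsto (fun l => 1 - Real.exp (-(c / N l))) atTop (𝓝 0) := by
    have h := (tendsto_inv_atTop_zero.comp hN).mul hexp
    rw [zero_mul] at h
    refine h.congr fun l => ?_
    simp only [Function.comp_apply]
    rw [← mul_assoc, inv_mul_cancel₀ (hNpos l).ne', one_mul]
  have hg : Tendsto (fun l => ((1 - Real.exp (-(c / N l)) : ℝ) : ℂ) * (w - 1)) atTop (𝓝 0) := by
    have := ((Complex.continuous_ofReal.tendsto _).comp hzero).mul_const (w - 1)
    simpa using this
  have hn : Tendsto (fun l => ((gridIndex t l - gridIndex s l : ℕ) : ℂ) *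
      (((1 - Real.exp (-(c / N l)) : ℝ) : ℂ) * (w - 1))) atTop
      (𝓝 ((c * (t - s) : ℝ≥0) * (w - 1))) := by
    have h := ((Complex.continuous_ofReal.tendsto _).comp hprod).mul_const (w - 1)
    refine h.congr fun l => ?_
    simp only [Function.comp_apply, Complex.ofReal_mul, Complex.ofReal_natCast]
    ring
  refine (tendsto_one_add_pow_cexp hg hn).congr fun l => ?_
  congr 1
  simp only [N]
  push_cast
  ring

section Poisson

variable {Ω : Type*} [MeasurableSpace Ω] {P : Measure Ω} {c : ℝ≥0} {e : ℕ → Ω → ℝ}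

theorem aemeasurable_countingProcess (hc : 0 < c) (he : IsStdExpSequence e P) (t : ℝ≥0) :
    AEMeasurable (fun ω => (countingProcess c c e t ω).toNat) P := by
  refine aemeasurable_of_tendsto_metrizable_ae (ι := ℕ) atTop (f := fun l ω =>
    renewalCount (fun k => gridHolding c e l k ω) (gridIndex t l)) (fun l =>
    (measurable_renewalCount (isGeometricSequence_gridHolding hc he l).measurable _).aemeasurable)
    ?_
  filter_upwards [he.ae_isRegularSample] with ω hω
  exact tendsto_const_nhds.congr' ((eventually_renewalCount_gridHolding hc hω t).mono
    fun l hl => hl.symm)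

/-- Both sides are limits of the discrete identity `integral_prod_pow_increments`; `‖w j‖ ≤ 1`
provides the domination. -/
theorem integral_prod_pow_countingProcess (hc : 0 < c) (he : IsStdExpSequence e P)
    {t : ℕ → ℝ≥0} (ht : Monotone t) {w : ℕ → ℂ} (hw : ∀ j, ‖w j‖ ≤ 1) (k : ℕ) :
    ∫ ω, ∏ j ∈ Finset.range k, w j ^ ((countingProcess c c e (t (j + 1)) ω).toNat -
      (countingProcess c c e (t j) ω).toNat) ∂P =
      ∏ j ∈ Finset.range k, Complex.exp ((c * (t (j + 1) - t j) : ℝ≥0) * (w j - 1)) := by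
  have := he.indep.isProbabilityMeasure
  have hgeo := isGeometricSequence_gridHolding hc he
  have hM := fun l => measurable_renewalCount (hgeo l).measurable
  have hlim := tendsto_finsetProd (Finset.range k) fun j _ =>
    tendsto_flip_transform c (ht (Nat.le_add_right j 1)) (w j)
  have hint : Tendsto (fun l : ℕ => ∫ ω, ∏ j ∈ Finset.range k,
      w j ^ (renewalCount (fun k => gridHolding c e l k ω) (gridIndex (t (j + 1)) l) -
        renewalCount (fun k => gridHolding c e l k ω) (gridIndex (t j) l)) ∂P) atTop
      (𝓝 (∫ ω, ∏ j ∈ Finset.range k, w j ^ ((countingProcess c c e (t (j + 1)) ω).toNat -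
        (countingProcess c c e (t j) ω).toNat) ∂P)) := by
    refine tendsto_integral_filter_of_dominated_convergence (fun _ => (1 : ℝ))
      (Eventually.of_forall fun l => ?_)
      (Eventually.of_forall fun l => Eventually.of_forall fun ω => ?_)
      (integrable_const _) ?_
    · refine Measurable.aestronglyMeasurable (Finset.measurable_fun_prod _ fun j _ => ?_)
      exact (measurable_of_countable fun m : ℕ => w j ^ m).comp ((hM l _).sub (hM l _))
    · rw [norm_prod]
      refine Finset.prod_le_one (fun _ _ => norm_nonneg _) fun j _ => ?_
      rw [norm_pow]
      exact pow_le_one₀ (norm_nonneg _) (hw j)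
    · filter_upwards [he.ae_isRegularSample] with ω hω
      refine tendsto_finsetProd _ fun j _ => tendsto_const_nhds.congr' ?_
      filter_upwards [eventually_renewalCount_gridHolding hc hω (t j),
        eventually_renewalCount_gridHolding hc hω (t (j + 1))] with l h1 h2
      rw [h1, h2]
  refine tendsto_nhds_unique hint (hlim.congr fun l => ?_)
  exact ((hgeo l).integral_prod_pow_increments w (fun i j hij => gridIndex_mono l (ht hij)) k).symm

/-- The increments of the counting process of rate `c` have the characteristic functions of
Poisson variables. -/
theorem charFun_map_countingProcess_sub (hc : 0 < c) (he : IsStdExpSequence e P)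
    {s t : ℝ≥0} (hst : s ≤ t) (x : ℝ) :
    charFun (P.map fun ω => (((countingProcess c c e t ω).toNat -
      (countingProcess c c e s ω).toNat : ℕ) : ℝ)) x =
      Complex.exp ((c * (t - s) : ℝ≥0) * (Complex.exp (x * Complex.I) - 1)) := by
  have hm : AEMeasurable (fun ω => (((countingProcess c c e t ω).toNat -
      (countingProcess c c e s ω).toNat : ℕ) : ℝ)) P :=
    (measurable_of_countable (Nat.cast : ℕ → ℝ)).comp_aemeasurable
      ((aemeasurable_countingProcess hc he t).sub (aemeasurable_countingProcess hc he s))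
  -- The time sequence `s, t, t, …` has the wanted increment as its first one.
  have hmono : Monotone fun j : ℕ => if j = 0 then s else t := by
    refine monotone_nat_of_le_succ fun j => ?_
    rcases j with - | j <;> simp [hst]
  have h := integral_prod_pow_countingProcess hc he hmono (w := fun _ => Complex.exp (x * Complex.I))
    (fun _ => (Complex.norm_exp_ofReal_mul_I x).le) 1
  simp only [Finset.prod_range_one, zero_add, one_ne_zero, if_true, if_false] at h
  rw [← h, charFun_apply, integral_map hm (by fun_prop)]
  refine integral_congr_ae (Eventually.of_forall fun ω => ?_)
  simp only [Real.inner_apply]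
  rw [← Complex.exp_nat_mul]
  push_cast
  ring_nf

/-- Characteristic functions identify the law after the cast to `ℝ`; the floor, a left inverse of
the cast, carries it back to `ℕ`. -/
theorem hasLaw_countingProcess_sub (hc : 0 < c) (he : IsStdExpSequence e P)
    {s t : ℝ≥0} (hst : s ≤ t) :
    HasLaw (fun ω => (countingProcess c c e t ω).toNat - (countingProcess c c e s ω).toNat)
      (poissonMeasure (c * (t - s))) P := by
  have := he.indep.isProbabilityMeasure
  have hm : AEMeasurable (fun ω => (countingProcess c c e t ω).toNat -
      (countingProcess c c e s ω).toNat) P := (aemeasurable_countingProcess hc he t).sub (aemeasurable_countingProcess hc he s)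
  have hcast := measurable_of_countable (Nat.cast : ℕ → ℝ)
  have hmcast : AEMeasurable (fun ω => (((countingProcess c c e t ω).toNat -
      (countingProcess c c e s ω).toNat : ℕ) : ℝ)) P := hcast.comp_aemeasurable hm
  refine ⟨hm, ?_⟩
  have hreal : P.map (fun ω => (((countingProcess c c e t ω).toNat -
      (countingProcess c c e s ω).toNat : ℕ) : ℝ)) =
      (poissonMeasure (c * (t - s))).map (Nat.cast : ℕ → ℝ) := by
    have := Measure.isProbabilityMeasure_map hmcast
    have := Measure.isProbabilityMeasure_map (μ := poissonMeasure (c * (t - s)))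
      hcast.aemeasurable
    refine Measure.ext_of_charFun (funext fun x => ?_)
    rw [charFun_map_cast_poissonMeasure]
    exact charFun_map_countingProcess_sub hc he hst x
  have hfloor : Measurable fun x : ℝ => ⌊x⌋₊ := Nat.measurable_floor
  have h := congrArg (Measure.map fun x : ℝ => ⌊x⌋₊) hreal
  rw [AEMeasurable.map_map_of_aemeasurable hfloor.aemeasurable hmcast,
    Measure.map_map hfloor hcast] at h
  simpa [Function.comp_def] using h

theorem hasIndepIncrements_countingProcess (hc : 0 < c) (he : IsStdExpSequence e P) :
    HasIndepIncrements (fun (t : ℝ≥0) ω => (countingProcess c c e t ω).toNat) P := by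
  have := he.indep.isProbabilityMeasure
  intro n t ht
  have hcast := measurable_of_countable (Nat.cast : ℕ → ℝ)
  have hm : ∀ i : Fin n, AEMeasurable (fun ω => (((countingProcess c c e (t i.succ) ω).toNat -
      (countingProcess c c e (t i.castSucc) ω).toNat : ℕ) : ℝ)) P := fun i =>
    hcast.comp_aemeasurable
      ((aemeasurable_countingProcess hc he _).sub (aemeasurable_countingProcess hc he _))
  suffices hreal : iIndepFun (fun (i : Fin n) ω =>
      (((countingProcess c c e (t i.succ) ω).toNat -
        (countingProcess c c e (t i.castSucc) ω).toNat : ℕ) : ℝ)) P by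
    have h := hreal.comp (fun _ (x : ℝ) => ⌊x⌋₊) fun _ => Nat.measurable_floor
    simpa [Function.comp_def] using h
  rw [iIndepFun_iff_charFun_pi hm]
  intro x
  -- The times are frozen after the last one and the bases padded by `1`; only indices below `n`
  -- enter the product.
  let t' : ℕ → ℝ≥0 := fun j => t ⟨min n j, by omega⟩
  have ht' : Monotone t' := fun i j hij => ht (Fin.mk_le_mk.2 (min_le_min_left n hij))
  let w : ℕ → ℂ := fun j => if hj : j < n then Complex.exp (x ⟨j, hj⟩ * Complex.I) else 1
  have hw : ∀ j, ‖w j‖ ≤ 1 := fun j => by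
    simp only [w]
    split_ifs
    · exact (Complex.norm_exp_ofReal_mul_I _).le
    · simp
  have htc : ∀ i : Fin n, t' i = t i.castSucc := fun i => congrArg t (Fin.ext (by simp [i.2.le]))
  have hts : ∀ i : Fin n, t' (i + 1) = t i.succ := fun i =>
    congrArg t (Fin.ext (by simp [Nat.succ_le_of_lt i.2]))
  have hwi : ∀ i : Fin n, w i = Complex.exp (x i * Complex.I) := fun i => by simp [w]
  have h := integral_prod_pow_countingProcess hc he ht' hw n
  simp only [Finset.prod_range, htc, hts, hwi] at h
  have hchar : ∀ i : Fin n, charFun (P.map fun ω =>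
      (((countingProcess c c e (t i.succ) ω).toNat -
        (countingProcess c c e (t i.castSucc) ω).toNat : ℕ) : ℝ)) (x i) = _ := fun i =>
    charFun_map_countingProcess_sub hc he (ht (Fin.castSucc_le_succ i)) (x i)
  simp only [hchar]
  rw [← h, charFun_apply, integral_map (by fun_prop) (by fun_prop)]
  refine integral_congr_ae (Eventually.of_forall fun ω => ?_)
  simp only [PiLp.inner_apply, Real.inner_apply]
  push_cast
  rw [Finset.sum_mul, Complex.exp_sum]
  refine Finset.prod_congr rfl fun i _ => ?_
  rw [← Complex.exp_nat_mul]
  ring_nf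

theorem isPoissonProcess_countingProcess (hc : 0 < c) (he : IsStdExpSequence e P) :
    IsPoissonProcess (fun (t : ℝ≥0) ω => (countingProcess c c e t ω).toNat) c P where
  zero := by
    filter_upwards [he.ae_isRegularSample] with ω hω
    have h : (0 : ℝ) < jumpTime c c e 0 ω := by
      simpa [jumpTime] using mul_pos (holdingMean_pos hc hc 0) (hω.1 0)
    rw [NNReal.coe_zero, countingProcess_eq hc hc hω (fun k hk => absurd hk k.not_lt_zero) h]
    rfl
  mono := by
    filter_upwards [he.ae_isRegularSample] with ω hω s t hst
    exact ENat.toNat_le_toNat (countingProcess_mono c c e ω (NNReal.coe_le_coe.2 hst))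
      (countingProcess_ne_top hc hc hω _)
  rightCont := by
    filter_upwards [he.ae_isRegularSample] with ω hω t
    obtain ⟨m, h1, h2⟩ := exists_jumpTime_index hc hc hω t
    refine tendsto_const_nhds.congr' ?_
    have hlt : ∀ᶠ s : ℝ≥0 in 𝓝[Set.Ici t] t, (s : ℝ) < jumpTime c c e m ω :=
      mem_nhdsWithin_of_mem_nhds
        (NNReal.continuous_coe.continuousAt.preimage_mem_nhds (Iio_mem_nhds h2))
    filter_upwards [self_mem_nhdsWithin, hlt] with s hs hs2
    rw [countingProcess_eq hc hc hω h1 h2, countingProcess_eq hc hc hω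
      (fun k hk => (h1 k hk).trans (NNReal.coe_le_coe.2 hs)) hs2]
  indep := hasIndepIncrements_countingProcess hc he
  law _ _ hst := hasLaw_countingProcess_sub hc he hst

end Poisson

/-! ### Assembly of the statements -/

theorem theorem2p1 (c₀ c₁ : ℝ≥0) (hc₀ : 0 < c₀) (hc₁ : 0 < c₁)
    {Ω : StepSize c₀ c₁ → Type*} [∀ Δ, MeasurableSpace (Ω Δ)]
    (μ : ∀ Δ, Measure (Ω Δ)) [∀ Δ, IsProbabilityMeasure (μ Δ)]
    (Y : ∀ Δ, ℕ → Ω Δ → ℤˣ)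
    (hY : ∀ Δ : StepSize c₀ c₁,
      IsMarkovChain (Y Δ) (transitionMatrix (c₀ * Δ.1) (c₁ * Δ.1)) (μ Δ))
    {Ω' : Type*} [MeasurableSpace Ω'] (P : Measure Ω') [IsProbabilityMeasure P]
    (e : ℕ → Ω' → ℝ) (he : IsStdExpSequence e P) :
    (∀ᵐ ω ∂P, ∀ t, countingProcess c₀ c₁ e t ω ≠ ⊤) ∧
    ((∀ Δ, ∀ᵐ ω ∂(μ Δ), Y Δ 0 ω = -1) →
      TendstoInDistribution (fun Δ => scaledWalk Δ.1 Δ.1 (Y Δ)) (stepToZero c₀ c₁)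
        (fun ω => -itn c₀ c₁ e ω) μ P) ∧
    (c₀ = c₁ → IsPoissonProcess
      (fun (t : ℝ≥0) ω => (countingProcess c₀ c₁ e t ω).toNat) c₀ P) ∧
    ((∀ Δ, ∀ᵐ ω ∂(μ Δ), Y Δ 0 ω = 1) →
      TendstoInDistribution (fun Δ => scaledWalk Δ.1 Δ.1 (Y Δ)) (stepToZero c₀ c₁)
        (fun ω => itn c₁ c₀ e ω) μ P) := by
  let ρ : ℤˣ → ℝ := fun x => if x = -1 then c₀ else c₁
  have hρ : ∀ x, 0 < ρ x := fun x => by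
    simp only [ρ]
    split_ifs
    · exact_mod_cast hc₀
    · exact_mod_cast hc₁
  have hρ₀ : ρ (-1) = c₀ := if_pos rfl
  have hρ₁ : ρ 1 = c₁ := if_neg (by decide)
  -- Holding times are indexed from `0`, so from `-1` the even indices are sojourns in `-1`, left at
  -- rate `c₀`; from `1` the roles are exchanged.
  have hmean₀ : ∀ k, holdingMean c₀ c₁ k = 1 / ρ (-1 * (-1) ^ k) := fun k => by
    rcases Nat.even_or_odd k with hk | hk
    · rw [holdingMean, if_pos hk.add_one, hk.neg_one_pow, mul_one, hρ₀]
    · rw [holdingMean, if_neg (Nat.not_odd_iff_even.2 hk.add_one), hk.neg_one_pow, neg_mul_neg,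
        one_mul, hρ₁]
  have hmean₁ : ∀ k, holdingMean c₁ c₀ k = 1 / ρ (1 * (-1) ^ k) := fun k => by
    rcases Nat.even_or_odd k with hk | hk
    · rw [holdingMean, if_pos hk.add_one, hk.neg_one_pow, mul_one, hρ₁]
    · rw [holdingMean, if_neg (Nat.not_odd_iff_even.2 hk.add_one), hk.neg_one_pow, one_mul, hρ₀]
  refine ⟨?_, fun h0 => ?_, ?_, fun h0 => ?_⟩
  · filter_upwards [he.ae_isRegularSample] with ω hω using countingProcess_ne_top hc₀ hc₁ hω
  · simpa using tendstoInDistribution_scaledWalk hc₀ hc₁ hρ hρ₀ hρ₁ hmean₀ μ Y hY P e he h0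
  · rintro rfl
    exact isPoissonProcess_countingProcess hc₀ he
  · simpa using tendstoInDistribution_scaledWalk hc₁ hc₀ hρ hρ₀ hρ₁ hmean₁ μ Y hY P e he h0
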